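/- Let $\phi$ be the standard normal density, $\gamma(u)=\frac{1}{\pi(1+u^2)}$ the standard Cauchy density and $g(x)=\int\phi(x-u)\gamma(u)\,du$. For $\theta\in\mathbb R^n$ let $P_\theta$ be the law of $X=(X_1,\dots,X_n)$ with independent $X_i\sim\mathcal N(\theta_i,1)$, and $E_\theta$ the corresponding expectation. For $\alpha\in(0,1]$, the posterior distribution for the spike-and-slab prior $\bigotimes_{i=1}^n\big((1-\alpha)\delta_0+\alpha\,\mathrm{Cauchy}(1)\big)$ is $$\Pi_\alpha[\,\cdot\mid X]=\bigotimes_{i=1}^n\Big((1-a_\alpha(X_i))\,\delta_0+a_\alpha(X_i)\,G_{X_i}\Big),\qquad a_\alpha(x)=\frac{\alpha g(x)}{(1-\alpha)\phi(x)+\alpha g(x)},$$ where $G_x$ has Lebesgue density $u\mapsto\phi(x-u)\gamma(u)/g(x)$. Let $t(\alpha)\ge 0$ be the threshold of the coordinatewise posterior median, that is, the number such that the posterior median of a coordinate with observation $x$ is $0$ if and only if $|x|\le t(\alpha)$; the function $t$ is a strictly decreasing bijection from $(0,1]$ onto $[0,\infty)$. Let $\alpha_n=t^{-1}(\sqrt{2\log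 n})$ and let $\hat\alpha$ be a maximiser over $[\alpha_n,1]$ of the log-marginal likelihood $$\alpha\mapsto\sum_{i=1}^n\log\big((1-\alpha)\phi(X_i)+\alpha g(X_i)\big).$$ For $A>0$ and $n\ge 3$ put $t_n=\sqrt{2\log n-5\log\log n}$ and define the modified estimator $$\hat\alpha_A=\begin{cases}\hat\alpha&\text{if }t(\hat\alpha)\le t_n,\\ t^{-1}\big(\sqrt{2(1+A)\log n}\big)&\text{if }t(\hat\alpha)>t_n.\end{cases}$$ Let $\ell_0[s]=\{\theta\in\mathbb R^n:\#\{i:\theta_i\ne 0\}\le s\}$ and $r_n=2s_n\log(n/s_n)$. Then for every fixed $A>0$ there exist $C>0$, $c_0>0$ and $N_0>0$ such that for all $n\ge N_0$ and all real $s_n$ with $1\le s_n\le c_0 n$, $$\sup_{\theta_0\in\ell_0[s_n]}E_{\theta_0}\int\|\theta-\theta_0\|^2\,d\Pi_{\hat\alpha_A}(\theta\mid X)\le C\,r_n .$$ -/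

import Mathlib

open MeasureTheory ProbabilityTheory
open scoped ENNReal

namespace SpikeSlab

noncomputable section

/-- The standard normal density. -/
def phi (x : ℝ) : ℝ := gaussianPDFReal 0 1 x

/-- The density of the slab, the standard Cauchy distribution. -/
def slab (u : ℝ) : ℝ := cauchyPDFReal 0 1 u

/-- The convolution of the normal density with the slab. -/
def g (x : ℝ) : ℝ := ∫ u, phi (x - u) * slab u

/-- The posterior weight of the slab, given an observation `x` and prior weight `α`. -/
def weight (α x : ℝ) : ℝ := α * g x / ((1 - α) * phi x + α * g x)

/-- The posterior law of a nonzero coefficient, with density `φ(x - u) γ(u) / g(x)`. -/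
def slabPosterior (x : ℝ) : Measure ℝ :=
  volume.withDensity fun u => ENNReal.ofReal (phi (x - u) * slab u / g x)

/-- The posterior law of one coefficient, given its observation `x`, for the prior
`(1 - α) δ₀ + α Cauchy(1)`. -/
def coordPosterior (α x : ℝ) : Measure ℝ :=
  ENNReal.ofReal (1 - weight α x) • Measure.dirac 0 +
    ENNReal.ofReal (weight α x) • slabPosterior x

/-- The posterior law of the vector `θ` given the observation `X`, for prior weight `α`. -/
def posterior {n : ℕ} (α : ℝ) (X : Fin n → ℝ) : Measure (Fin n → ℝ) :=
  Measure.pi fun i => coordPosterior α (X i)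

/-- The law `P_θ` of the data: independent `N(θ i, 1)` coordinates. -/
def dataLaw {n : ℕ} (θ : Fin n → ℝ) : Measure (Fin n → ℝ) :=
  Measure.pi fun i => gaussianReal (θ i) 1

/-- `m` is a median of the measure `μ`. -/
def IsMedian (μ : Measure ℝ) (m : ℝ) : Prop :=
  1 / 2 ≤ μ (Set.Iic m) ∧ 1 / 2 ≤ μ (Set.Ici m)

/-- The threshold `t(α)` of the posterior median, for `0 < α ≤ 1`: the largest `x ≥ 0` at which
the posterior median is zero. The posterior median at `x` is zero if and only if `|x| ≤ t(α)`. -/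
def threshold (α : ℝ) : ℝ := sSup {x : ℝ | 0 ≤ x ∧ IsMedian (coordPosterior α x) 0}

/-- The inverse of the threshold function, which is a decreasing bijection from `(0, 1]`
onto `[0, ∞)`. -/
def thresholdInv (u : ℝ) : ℝ := Function.invFunOn threshold (Set.Ioc 0 1) u

/-- The log-marginal likelihood of the weight. -/
def logLik {n : ℕ} (X : Fin n → ℝ) (α : ℝ) : ℝ :=
  ∑ i, Real.log ((1 - α) * phi (X i) + α * g (X i))

/-- The lower end point `α_n` of the range of the weight: `t(α_n) = √(2 log n)`. -/
def alphaMin (n : ℕ) : ℝ := thresholdInv (√(2 * Real.log n))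

/-- `a` is a marginal maximum likelihood estimate of the weight: it maximises the log-marginal
likelihood over `[α_n, 1]`. -/
def IsMMLE {n : ℕ} (X : Fin n → ℝ) (a : ℝ) : Prop :=
  a ∈ Set.Icc (alphaMin n) 1 ∧ IsMaxOn (logLik X) (Set.Icc (alphaMin n) 1) a

/-- The modification `α̂_A` of an estimate `a` of the weight: `a` itself if `t(a) ≤ t_n`, where
`t_n² = 2 log n - 5 log log n`, and `t⁻¹(√(2 (1 + A) log n))` otherwise. -/
def modify (A : ℝ) (n : ℕ) (a : ℝ) : ℝ :=
  open scoped Classical in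
  if threshold a ≤ √(2 * Real.log n - 5 * Real.log (Real.log n)) then a
  else thresholdInv (√(2 * (1 + A) * Real.log n))

/-- The vectors with at most `s` nonzero coordinates. -/
def sparse (n : ℕ) (s : ℝ) : Set (Fin n → ℝ) :=
  {θ | (({i | θ i ≠ 0} : Set (Fin n)).ncard : ℝ) ≤ s}

/-- The posterior second moment `∫ ‖θ - θ₀‖² dΠ_α(θ | X)` around `θ₀`. -/
def posteriorLoss {n : ℕ} (α : ℝ) (θ₀ X : Fin n → ℝ) : ℝ≥0∞ :=
  ∫⁻ θ, ENNReal.ofReal (∑ i, (θ i - θ₀ i) ^ 2) ∂(posterior α X)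

/-- The minimax rate `r_n = 2 s log (n / s)`. -/
def rate (n : ℕ) (s : ℝ) : ℝ := 2 * s * Real.log (n / s)

end

end SpikeSlab

/-!
The signals are controlled for every realisation of the data. As `α̂` maximises the likelihood, the
likelihood equation bounds `∑ i, g (X i) / ((1 - α̂) φ (X i) + α̂ g (X i))` by `n`, and
`(1 - a_α (x)) x²` is at most `4 log (n / s)` plus a multiple of `s / n` times a summand. This
remains true for the fallback weight if `s ≥ √n`; if `s ≤ √n`, then `log n ≤ 2 log (n / s)` and the
threshold of the fallback weight itself is small enough.

For the noise, the log-likelihood is concave in `α`, so that `α̂` can exceed a deterministic level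
`ᾱ` of order `(s / n) √(log (n / s))` only if the score at `ᾱ` is nonnegative. The score has a
negative drift, and a Chernoff bound for a bounded multiple of it, under which the coordinates stay
independent, shows that this event contributes `O(1 / n)` per coordinate. When `s` is below
`(log n)²`, the level `ᾱ` for `(log n)²` is smaller than the weight with threshold `t_n`; an
estimate below it is therefore replaced by the fallback weight, which is so small that the noise
costs `O(1)` in total.
-/

namespace SpikeSlab

open Filter Real Set

section Densities

theorem phi_eq (x : ℝ) : phi x = (√(2 * π))⁻¹ * exp (-x ^ 2 / 2) := by
  simp [phi, gaussianPDFReal]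

theorem slab_eq (u : ℝ) : slab u = π⁻¹ * (1 + u ^ 2)⁻¹ := by
  simp [slab, cauchyPDFReal, add_comm]

theorem phi_pos (x : ℝ) : 0 < phi x := gaussianPDFReal_pos _ _ _ one_ne_zero

theorem slab_pos (u : ℝ) : 0 < slab u := cauchyPDF_pos _ one_ne_zero _

theorem continuous_phi : Continuous phi := by
  simp only [funext phi_eq]
  fun_prop

theorem continuous_slab : Continuous slab := by
  simp only [funext slab_eq]
  exact continuous_const.mul (Continuous.inv₀ (by fun_prop) fun x => by positivity)

theorem integrable_phi : Integrable phi := integrable_gaussianPDFReal _ _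

theorem integrable_slab : Integrable slab := integrable_cauchyPDFReal _

theorem integral_phi : ∫ x, phi x = 1 := integral_gaussianPDFReal_eq_one _ one_ne_zero

theorem integral_slab : ∫ x, slab x = 1 := integral_cauchyPDFReal_eq_one _ one_ne_zero

theorem phi_neg (x : ℝ) : phi (-x) = phi x := by simp [phi_eq]

theorem slab_neg (x : ℝ) : slab (-x) = slab x := by simp [slab_eq]

theorem phi_le (x : ℝ) : phi x ≤ 1 / 2 * exp (-x ^ 2 / 2) := by
  have h : 2 ≤ √(2 * π) := le_sqrt_of_sq_le (by linarith [pi_gt_three])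
  rw [phi_eq, one_div]
  gcongr

theorem le_phi (x : ℝ) : 1 / 3 * exp (-x ^ 2 / 2) ≤ phi x := by
  have h : √(2 * π) ≤ 3 := sqrt_le_iff.2 ⟨by norm_num, by linarith [pi_le_four]⟩
  rw [phi_eq, one_div]
  gcongr

theorem phi_le_half (x : ℝ) : phi x ≤ 1 / 2 := by
  have h : exp (-x ^ 2 / 2) ≤ 1 := exp_le_one_iff.2 (by linarith [sq_nonneg x])
  linarith [phi_le x]

theorem one_sixth_le_phi {x : ℝ} (hx : x ^ 2 ≤ 1) : 1 / 6 ≤ phi x := by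
  linarith [le_phi x, add_one_le_exp (-x ^ 2 / 2)]

theorem inv_pi_le : π⁻¹ ≤ 1 / 3 := by
  rw [one_div]
  exact inv_anti₀ (by norm_num) pi_gt_three.le

theorem le_inv_pi : 1 / 4 ≤ π⁻¹ := by
  rw [one_div]
  exact inv_anti₀ pi_pos pi_le_four

theorem slab_le (u : ℝ) : slab u ≤ 1 / 3 := by
  have h : (1 + u ^ 2)⁻¹ ≤ 1 := inv_le_one_of_one_le₀ (by linarith [sq_nonneg u])
  rw [slab_eq]
  exact (mul_le_of_le_one_right (by positivity) h).trans inv_pi_le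

theorem one_add_sq_mul_slab_le (x u : ℝ) :
    (1 + x ^ 2) * slab u ≤ 2 / 3 * (1 + (x - u) ^ 2) := by
  have peetre : (1 + x ^ 2) * (1 + u ^ 2)⁻¹ ≤ 2 * (1 + (x - u) ^ 2) := by
    rw [mul_inv_le_iff₀ (by positivity)]
    nlinarith [sq_nonneg (x - 2 * u), sq_nonneg ((x - u) * u)]
  calc (1 + x ^ 2) * slab u = π⁻¹ * ((1 + x ^ 2) * (1 + u ^ 2)⁻¹) := by rw [slab_eq]; ring
    _ ≤ 1 / 3 * (2 * (1 + (x - u) ^ 2)) := by gcongr; exact inv_pi_le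
    _ = _ := by ring

theorem le_slab_of_near {x u : ℝ} (h : (x - u) ^ 2 ≤ 1) : 1 / 12 / (1 + x ^ 2) ≤ slab u := by
  have hxu : 1 + u ^ 2 ≤ 3 * (1 + x ^ 2) := by linarith [sq_nonneg (u - 2 * x), sq_nonneg x]
  calc 1 / 12 / (1 + x ^ 2) = 1 / 4 * (3 * (1 + x ^ 2))⁻¹ := by field_simp; norm_num
    _ ≤ π⁻¹ * (1 + u ^ 2)⁻¹ := by gcongr; exact le_inv_pi
    _ = slab u := (slab_eq u).symm

end Densities

section Moments

theorem integrable_pow_mul_phi (k : ℕ) : Integrable fun v => v ^ k * phi v := by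
  have h := integrable_rpow_mul_exp_neg_mul_sq (b := 1 / 2) (by norm_num) (s := k)
    (by linarith [(k.cast_nonneg : (0 : ℝ) ≤ k)])
  refine (h.const_mul (√(2 * π))⁻¹).congr (Eventually.of_forall fun x => ?_)
  simp only [phi_eq, rpow_natCast]
  ring_nf

theorem hasDerivAt_phi (x : ℝ) : HasDerivAt phi (-x * phi x) x := by
  have h : HasDerivAt (fun x : ℝ => -x ^ 2 / 2) (-x) x := by
    refine ((hasDerivAt_pow 2 x).neg.div_const 2).congr_deriv ?_
    norm_num
    ring
  rw [funext phi_eq]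
  exact (h.exp.const_mul (√(2 * π))⁻¹).congr_deriv (by ring)

theorem integral_pow_add_two_mul_phi (k : ℕ) :
    ∫ v, v ^ (k + 2) * phi v = (k + 1) * ∫ v, v ^ k * phi v := by
  have hderiv : ∀ v, HasDerivAt (fun v => v ^ (k + 1) * phi v)
      ((k + 1) * (v ^ k * phi v) - v ^ (k + 2) * phi v) v := fun v => by
    refine ((hasDerivAt_pow (k + 1) v).mul (hasDerivAt_phi v)).congr_deriv ?_
    rw [Nat.add_sub_cancel]
    push_cast
    ring
  have hk := (integrable_pow_mul_phi k).const_mul (k + 1 : ℝ)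
  have h := integral_eq_zero_of_hasDerivAt_of_integrable hderiv
    (hk.sub (integrable_pow_mul_phi (k + 2))) (integrable_pow_mul_phi (k + 1))
  rw [integral_sub hk (integrable_pow_mul_phi (k + 2)), integral_const_mul] at h
  linarith

theorem integral_sq_mul_phi : ∫ v, v ^ 2 * phi v = 1 := by
  simpa [integral_phi] using integral_pow_add_two_mul_phi 0

theorem integral_pow_four_mul_phi : ∫ v, v ^ 4 * phi v = 3 := by
  rw [integral_pow_add_two_mul_phi 2, integral_sq_mul_phi]
  norm_num

variable {K : ℝ → ℝ}

theorem integrable_comp_sub_mul_slab (hK : Integrable K) (x : ℝ) :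
    Integrable fun u => K (x - u) * slab u := by
  refine (hK.comp_sub_left x).mul_bdd (c := 1 / 3) continuous_slab.aestronglyMeasurable
    (Eventually.of_forall fun u => ?_)
  rw [norm_of_nonneg (slab_pos u).le]
  exact slab_le u

theorem one_add_sq_mul_integral_comp_sub_mul_slab_le (h0 : ∀ v, 0 ≤ K v) (hK : Integrable K)
    (hK2 : Integrable fun v => v ^ 2 * K v) (x : ℝ) :
    (1 + x ^ 2) * ∫ u, K (x - u) * slab u ≤ 2 / 3 * ((∫ v, K v) + ∫ v, v ^ 2 * K v) := by
  have hi : Integrable fun v => 2 / 3 * (K v + v ^ 2 * K v) := (hK.add hK2).const_mul _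
  calc (1 + x ^ 2) * ∫ u, K (x - u) * slab u
      = ∫ u, (1 + x ^ 2) * (K (x - u) * slab u) := (integral_const_mul _ _).symm
    _ ≤ ∫ u, 2 / 3 * (K (x - u) + (x - u) ^ 2 * K (x - u)) := by
        refine integral_mono ((integrable_comp_sub_mul_slab hK x).const_mul _)
          (hi.comp_sub_left x) fun u => ?_
        have := mul_le_mul_of_nonneg_left (one_add_sq_mul_slab_le x u) (h0 (x - u))
        linarith
    _ = ∫ v, 2 / 3 * (K v + v ^ 2 * K v) :=
        integral_sub_left_eq_self (fun v => 2 / 3 * (K v + v ^ 2 * K v)) volume x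
    _ = _ := by rw [integral_const_mul, integral_add hK hK2]

theorem integrable_conv (x : ℝ) : Integrable fun u => phi (x - u) * slab u :=
  integrable_comp_sub_mul_slab integrable_phi x

theorem integrable_sq_mul_conv (x : ℝ) :
    Integrable fun u => (u - x) ^ 2 * (phi (x - u) * slab u) := by
  refine (integrable_comp_sub_mul_slab (integrable_pow_mul_phi 2) x).congr
    (Eventually.of_forall fun u => ?_)
  ring

theorem integral_sq_mul_conv_le (x : ℝ) :
    ∫ u, (u - x) ^ 2 * (phi (x - u) * slab u) ≤ 8 / 3 / (1 + x ^ 2) := by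
  have h4 : (fun v => v ^ 2 * (v ^ 2 * phi v)) = fun v => v ^ 4 * phi v := by ext v; ring
  have h := one_add_sq_mul_integral_comp_sub_mul_slab_le (K := fun v => v ^ 2 * phi v)
    (fun v => mul_nonneg (sq_nonneg v) (phi_pos v).le) (integrable_pow_mul_phi 2)
    (h4 ▸ integrable_pow_mul_phi 4) x
  simp only [h4, integral_sq_mul_phi, integral_pow_four_mul_phi] at h
  rw [le_div_iff₀' (by positivity)]
  calc _ = (1 + x ^ 2) * ∫ u, (x - u) ^ 2 * phi (x - u) * slab u := by
        congr 2 with u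
        ring
    _ ≤ 8 / 3 := by linarith

end Moments

section Marginal

theorem g_le (x : ℝ) : g x ≤ 2 / (1 + x ^ 2) := by
  have h := one_add_sq_mul_integral_comp_sub_mul_slab_le (fun v => (phi_pos v).le) integrable_phi
    (integrable_pow_mul_phi 2) x
  rw [integral_phi, integral_sq_mul_phi] at h
  rw [le_div_iff₀' (by positivity), g]
  linarith

theorem le_g (x : ℝ) : 1 / 36 / (1 + x ^ 2) ≤ g x :=
  calc 1 / 36 / (1 + x ^ 2)
      = ∫ _ in Icc (x - 1) (x + 1), 1 / 6 * (1 / 12 / (1 + x ^ 2)) := by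
        rw [setIntegral_const, measureReal_def, volume_Icc, ENNReal.toReal_ofReal (by linarith),
          smul_eq_mul]
        ring
    _ ≤ ∫ u in Icc (x - 1) (x + 1), phi (x - u) * slab u := by
        refine setIntegral_mono_on (integrableOn_const (by simp)) (integrable_conv x).integrableOn
          measurableSet_Icc fun u hu => ?_
        have hxu : (x - u) ^ 2 ≤ 1 := by nlinarith [hu.1, hu.2]
        exact mul_le_mul (one_sixth_le_phi hxu) (le_slab_of_near hxu) (by positivity)
          (phi_pos _).le
    _ ≤ g x := setIntegral_le_integral (integrable_conv x)
        (Eventually.of_forall fun u => (mul_pos (phi_pos _) (slab_pos u)).le)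

theorem g_pos (x : ℝ) : 0 < g x := lt_of_lt_of_le (by positivity) (le_g x)

theorem continuous_g : Continuous g := by
  refine continuous_of_dominated (bound := slab) (fun x => (integrable_conv x).1)
    (fun x => Eventually.of_forall fun u => ?_) integrable_slab
    (Eventually.of_forall fun u => ?_)
  · rw [norm_of_nonneg (mul_pos (phi_pos _) (slab_pos u)).le]
    exact mul_le_of_le_one_left (slab_pos u).le ((phi_le_half _).trans (by norm_num))
  · exact (continuous_phi.comp (by fun_prop)).mul continuous_const

theorem g_eq_convolution : g = convolution phi slab (ContinuousLinearMap.mul ℝ ℝ) volume := by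
  ext x
  rw [g, ← integral_sub_left_eq_self (fun u => phi (x - u) * slab u) volume x]
  simp [convolution]

theorem integrable_g : Integrable g := by
  rw [g_eq_convolution]
  exact integrable_phi.integrable_convolution _ integrable_slab

theorem integral_g : ∫ x, g x = 1 := by
  rw [g_eq_convolution, integral_convolution _ integrable_phi integrable_slab]
  simp [integral_phi, integral_slab]

theorem one_add_sq_le_exp {y : ℝ} (hy : 0 ≤ y) : (1 + y) ^ 2 ≤ 64 * exp (y / 4) := by
  calc (1 + y) ^ 2 ≤ (8 * exp (y / 8)) ^ 2 := by
        gcongr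
        linarith [add_one_le_exp (y / 8)]
    _ = 64 * exp (y / 4) := by
        rw [mul_pow, ← exp_nat_mul]
        ring_nf

theorem one_add_sq_mul_phi_le_exp_mul_g (x : ℝ) :
    (1 + x ^ 2) * phi x ≤ 1152 * exp (-x ^ 2 / 4) * g x := by
  have hg : 1 ≤ 36 * ((1 + x ^ 2) * g x) := by
    have := le_g x
    rw [div_le_iff₀' (by positivity)] at this
    linarith
  have hexp : exp (-x ^ 2 / 2) * exp (x ^ 2 / 4) = exp (-x ^ 2 / 4) := by
    rw [← exp_add]
    ring_nf
  calc (1 + x ^ 2) * phi x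
      ≤ (1 + x ^ 2) * (1 / 2 * exp (-x ^ 2 / 2)) * (36 * ((1 + x ^ 2) * g x)) := by
        refine (mul_le_mul_of_nonneg_left (phi_le x) (by positivity)).trans ?_
        exact le_mul_of_one_le_right (by positivity) hg
    _ = 18 * (1 + x ^ 2) ^ 2 * exp (-x ^ 2 / 2) * g x := by ring
    _ ≤ 18 * (64 * exp (x ^ 2 / 4)) * exp (-x ^ 2 / 2) * g x := by
        have := (g_pos x).le
        gcongr
        exact one_add_sq_le_exp (sq_nonneg x)
    _ = 1152 * exp (-x ^ 2 / 4) * g x := by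
        rw [← hexp]
        ring

theorem phi_le_exp_mul_g (x : ℝ) : phi x ≤ 1152 * exp (-x ^ 2 / 4) * g x :=
  (le_mul_of_one_le_left (phi_pos x).le (by linarith [sq_nonneg x])).trans
    (one_add_sq_mul_phi_le_exp_mul_g x)

end Marginal

section Mixture

variable {Ω ι : Type*} [Fintype ι] {p q : Ω → ℝ} {X : ι → Ω} {α β : ℝ}

/-- The density of the two-component mixture that puts weight `α` on `q` and `1 - α` on `p`. -/
def mixture (p q : Ω → ℝ) (α : ℝ) (x : Ω) : ℝ := (1 - α) * p x + α * q x

/-- The log-likelihood of the mixture weight, given the sample `X`. -/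
noncomputable def logLikelihood (p q : Ω → ℝ) (X : ι → Ω) (α : ℝ) : ℝ :=
  ∑ i, log (mixture p q α (X i))

/-- The score of the sample `X`, that is, the derivative of its log-likelihood in the weight. -/
noncomputable def score (p q : Ω → ℝ) (X : ι → Ω) (α : ℝ) : ℝ :=
  ∑ i, (q (X i) - p (X i)) / mixture p q α (X i)

theorem mixture_eq_add (x : Ω) : mixture p q α x = p x + α * (q x - p x) := by
  rw [mixture]
  ring

theorem mixture_pos (hp : ∀ x, 0 < p x) (hq : ∀ x, 0 < q x) (h0 : 0 < α) (h1 : α ≤ 1) (x : Ω) :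
    0 < mixture p q α x :=
  add_pos_of_nonneg_of_pos (mul_nonneg (sub_nonneg.2 h1) (hp x).le) (mul_pos h0 (hq x))

theorem mixture_eq_add_sub_mul (x : Ω) :
    mixture p q α x = mixture p q β x + (α - β) * (q x - p x) := by
  rw [mixture, mixture]
  ring

section Likelihood

variable {l : ℝ} (hp : ∀ x, 0 < p x) (hq : ∀ x, 0 < q x)

include hp hq

-- The log-likelihood is concave, so it lies below its tangents.
theorem logLikelihood_sub_le (hα : α ∈ Ioc 0 1) (hβ : β ∈ Ioc 0 1) :
    logLikelihood p q X α - logLikelihood p q X β ≤ (α - β) * score p q X β := by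
  rw [logLikelihood, logLikelihood, score, ← Finset.sum_sub_distrib, Finset.mul_sum]
  refine Finset.sum_le_sum fun i _ => ?_
  have hα' := mixture_pos hp hq hα.1 hα.2 (X i)
  have hβ' := mixture_pos hp hq hβ.1 hβ.2 (X i)
  calc log (mixture p q α (X i)) - log (mixture p q β (X i))
      = log (mixture p q α (X i) / mixture p q β (X i)) := (log_div hα'.ne' hβ'.ne').symm
    _ ≤ mixture p q α (X i) / mixture p q β (X i) - 1 :=
        log_le_sub_one_of_pos (div_pos hα' hβ')
    _ = (α - β) * ((q (X i) - p (X i)) / mixture p q β (X i)) := by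
        rw [div_sub_one hβ'.ne', mixture_eq_add_sub_mul (α := α) (β := β) (X i)]
        ring

theorem continuousAt_score (h0 : 0 < α) (h1 : α ≤ 1) : ContinuousAt (score p q X) α := by
  refine tendsto_finsetSum _ fun i _ => ContinuousAt.div continuousAt_const ?_
    (mixture_pos hp hq h0 h1 (X i)).ne'
  unfold mixture
  fun_prop

theorem score_nonneg_of_lt_of_isMaxOn (hl : 0 < l) (hα : α ≤ 1)
    (hmax : IsMaxOn (logLikelihood p q X) (Icc l 1) α) (hβ : l ≤ β) (hβα : β < α) :
    0 ≤ score p q X β := by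
  have htangent := logLikelihood_sub_le (X := X) hp hq (α := α) (β := β)
    ⟨by linarith, hα⟩ ⟨by linarith, by linarith⟩
  have hle : logLikelihood p q X β ≤ logLikelihood p q X α := hmax ⟨hβ, by linarith⟩
  exact nonneg_of_mul_nonneg_right (by linarith : 0 ≤ (α - β) * score p q X β) (by linarith)

theorem score_nonpos_of_isMaxOn (hl : 0 < l) (hlα : l ≤ α) (hα : α < 1)
    (hmax : IsMaxOn (logLikelihood p q X) (Icc l 1) α) : score p q X α ≤ 0 := by
  have h0 : 0 < α := by linarith
  refine le_of_tendsto ((continuousAt_score (X := X) hp hq h0 hα.le).tendsto.mono_left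
    (nhdsWithin_le_nhds (s := Ioi α))) ?_
  filter_upwards [Ioc_mem_nhdsGT hα] with β hβ
  have htangent := logLikelihood_sub_le (X := X) hp hq (α := α) (β := β)
    ⟨h0, hα.le⟩ ⟨by linarith [hβ.1], hβ.2⟩
  have hle : logLikelihood p q X β ≤ logLikelihood p q X α := hmax ⟨by linarith [hβ.1], hβ.2⟩
  exact nonpos_of_mul_nonneg_right (by linarith : 0 ≤ (α - β) * score p q X β)
    (by linarith [hβ.1])

theorem sum_div_mixture_eq (h0 : 0 < α) (h1 : α ≤ 1) :
    ∑ i, q (X i) / mixture p q α (X i) = Fintype.card ι + (1 - α) * score p q X α := by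
  rw [score, Finset.mul_sum, Fintype.card, Finset.cast_card, ← Finset.sum_add_distrib]
  refine Finset.sum_congr rfl fun i _ => ?_
  have hd := (mixture_pos hp hq h0 h1 (X i)).ne'
  rw [div_eq_iff hd, add_mul, mul_assoc, div_mul_cancel₀ _ hd, mixture]
  ring

-- At an interior maximiser this is the likelihood equation, with equality.
theorem sum_div_mixture_le_card (hl : 0 < l) (hα : α ∈ Icc l 1)
    (hmax : IsMaxOn (logLikelihood p q X) (Icc l 1) α) :
    ∑ i, q (X i) / mixture p q α (X i) ≤ Fintype.card ι := by
  have h : (1 - α) * score p q X α ≤ 0 := by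
    rcases hα.2.lt_or_eq with hα1 | rfl
    · exact mul_nonpos_of_nonneg_of_nonpos (by linarith)
        (score_nonpos_of_isMaxOn hp hq hl hα.1 hα1 hmax)
    · simp
  linarith [sum_div_mixture_eq (X := X) hp hq (hl.trans_le hα.1) hα.2]

end Likelihood

/-- The score of one observation, scaled so as to be at most `1 / 2` whatever the weight `α`. -/
noncomputable def tilt (p q : Ω → ℝ) (α : ℝ) (x : Ω) : ℝ :=
  α * (q x - p x) / mixture p q α x / 2

theorem sum_tilt : ∑ i, tilt p q α (X i) = α / 2 * score p q X α := by
  rw [score, Finset.mul_sum]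
  refine Finset.sum_congr rfl fun i _ => ?_
  rw [tilt]
  ring

section Pointwise

variable (hp : ∀ x, 0 < p x) (hq : ∀ x, 0 < q x)

include hp hq

theorem div_mixture_nonneg (h0 : 0 < α) (h1 : α ≤ 1) (x : Ω) : 0 ≤ q x / mixture p q α x :=
  (div_pos (hq x) (mixture_pos hp hq h0 h1 x)).le

theorem div_mixture_le (h0 : 0 < α) (h1 : α ≤ 1) (x : Ω) : q x / mixture p q α x ≤ 1 / α := by
  rw [div_le_div_iff₀ (mixture_pos hp hq h0 h1 x) h0, mixture]
  linarith [mul_nonneg (sub_nonneg.2 h1) (hp x).le]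

theorem mul_div_mixture_le (h0 : 0 < α) (h1 : α ≤ 1 / 2) (x : Ω) :
    p x * (q x / mixture p q α x) ≤ 2 * q x := by
  have hle : p x ≤ 2 * mixture p q α x := by
    rw [mixture]
    linarith [mul_le_mul_of_nonneg_right h1 (hp x).le, mul_pos h0 (hq x)]
  rw [← mul_div_assoc, div_le_iff₀ (mixture_pos hp hq h0 (by linarith) x)]
  nlinarith [hq x]

theorem tilt_le_half (h0 : 0 < α) (h1 : α ≤ 1) (x : Ω) : tilt p q α x ≤ 1 / 2 := by
  have h : α * (q x - p x) / mixture p q α x ≤ 1 := by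
    rw [div_le_one (mixture_pos hp hq h0 h1 x), mixture_eq_add]
    linarith [hp x]
  rw [tilt]
  linarith

theorem exp_tilt_le_two (h0 : 0 < α) (h1 : α ≤ 1) (x : Ω) : exp (tilt p q α x) ≤ 2 := by
  have h : exp (1 / 2) ≤ 2 := by
    rw [exp_half, sqrt_le_left (by norm_num)]
    linarith [exp_one_lt_d9]
  exact (exp_le_exp.2 (tilt_le_half hp hq h0 h1 x)).trans h

-- With `t = tilt p q α x` and `m = mixture p q α x`, expand `exp t ≤ 1 + t + t ^ 2` and use
-- `p x = (1 - 2 * t) * m`.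
theorem mul_exp_tilt_le (h0 : 0 < α) (h1 : α ≤ 1 / 4) (x : Ω) :
    p x * exp (tilt p q α x) ≤ p x + α * (q x - p x) / 2 -
      (α * (q x - p x)) ^ 2 / mixture p q α x / 6 := by
  have hm : 0 < mixture p q α x := mixture_pos hp hq h0 (by linarith) x
  set t := tilt p q α x with ht
  have htm : 2 * t * mixture p q α x = α * (q x - p x) := by
    rw [ht, tilt]
    field_simp
  have hpt : p x = (1 - 2 * t) * mixture p q α x := by
    rw [sub_mul, htm, mixture_eq_add]
    ring
  have ht_le : t ≤ 1 / 2 := tilt_le_half hp hq h0 (by linarith) x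
  have le_ht : -(1 / 6) ≤ t := by
    have hαp : α * p x ≤ 1 / 4 * p x := mul_le_mul_of_nonneg_right h1 (hp x).le
    have : 0 ≤ (6 * t + 1) * mixture p q α x := by
      linarith [mul_pos h0 (hq x)]
    have := nonneg_of_mul_nonneg_left this hm
    linarith
  have hexp : exp t ≤ 1 + t + t ^ 2 := by
    have := (abs_le.1 (abs_exp_sub_one_sub_id_le
      (abs_le.2 ⟨by linarith, by linarith⟩ : |t| ≤ 1))).2
    linarith
  have hsq : (α * (q x - p x)) ^ 2 / mixture p q α x = 4 * t ^ 2 * mixture p q α x := by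
    rw [← htm]
    field_simp
    ring
  calc p x * exp t ≤ p x * (1 + t + t ^ 2) := mul_le_mul_of_nonneg_left hexp (hp x).le
    _ = p x + t * mixture p q α x - t ^ 2 * (1 + 2 * t) * mixture p q α x := by
        rw [hpt]
        ring
    _ ≤ p x + t * mixture p q α x - t ^ 2 * (2 / 3) * mixture p q α x := by
        gcongr
        linarith
    _ = _ := by
        rw [hsq, ← htm]
        ring

theorem mul_exp_tilt_le_sub (h0 : 0 < α) (h1 : α ≤ 1 / 4) {x : Ω} (hx : 2 * p x ≤ α * q x) :
    p x * exp (tilt p q α x) ≤ p x + α * (q x - p x) / 2 - α / 24 * q x := by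
  have hp' := hp x
  have hm : 0 < mixture p q α x := mixture_pos hp hq h0 (by linarith) x
  have hαp : α * p x ≤ p x := mul_le_of_le_one_left hp'.le (by linarith)
  have hle : mixture p q α x ≤ 2 * (α * (q x - p x)) := by
    rw [mixture_eq_add]
    linarith
  have hnonneg : 0 ≤ α * (q x - p x) := by linarith
  have hsq : α * (q x - p x) / 2 ≤ (α * (q x - p x)) ^ 2 / mixture p q α x := by
    rw [le_div_iff₀ hm]
    linarith [mul_le_mul_of_nonneg_left hle hnonneg]
  linarith [mul_exp_tilt_le hp hq h0 h1 x]

end Pointwise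

section Integral

variable [MeasurableSpace Ω] {μ : Measure Ω}

theorem lintegral_ofReal_le_of_le {f h : Ω → ℝ} (hfh : f ≤ h) (h0 : 0 ≤ h) (hh : Integrable h μ)
    {c : ℝ} (hc : ∫ x, h x ∂μ ≤ c) :
    ∫⁻ x, ENNReal.ofReal (f x) ∂μ ≤ ENNReal.ofReal c :=
  calc ∫⁻ x, ENNReal.ofReal (f x) ∂μ ≤ ∫⁻ x, ENNReal.ofReal (h x) ∂μ :=
        lintegral_mono fun x => ENNReal.ofReal_le_ofReal (hfh x)
    _ = ENNReal.ofReal (∫ x, h x ∂μ) :=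
        (ofReal_integral_eq_lintegral_ofReal hh (Eventually.of_forall h0)).symm
    _ ≤ ENNReal.ofReal c := ENNReal.ofReal_le_ofReal hc

theorem lintegral_mul_exp_tilt_le (hp : ∀ x, 0 < p x) (hq : ∀ x, 0 < q x) (hpi : Integrable p μ)
    (hqi : Integrable q μ) (hp1 : ∫ x, p x ∂μ = 1) (hq1 : ∫ x, q x ∂μ = 1) (h0 : 0 < α)
    (h1 : α ≤ 1 / 4) {S : Set Ω} (hS : MeasurableSet S) (hpq : ∀ x ∈ S, 2 * p x ≤ α * q x) :
    ∫⁻ x, ENNReal.ofReal (p x * exp (tilt p q α x)) ∂μ ≤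
      ENNReal.ofReal (exp (-(α / 24 * ∫ x in S, q x ∂μ))) := by
  have hi0 : Integrable (fun x => α * (q x - p x) / 2) μ :=
    ((hqi.sub hpi).const_mul _).div_const _
  have hi1 : Integrable (fun x => p x + α * (q x - p x) / 2) μ := hpi.add hi0
  have hi2 : Integrable (S.indicator fun x => α / 24 * q x) μ := (hqi.const_mul _).indicator hS
  have hle : ∀ x, p x * exp (tilt p q α x) ≤
      p x + α * (q x - p x) / 2 - S.indicator (fun x => α / 24 * q x) x := fun x => by
    by_cases hx : x ∈ S
    · rw [indicator_of_mem hx]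
      exact mul_exp_tilt_le_sub hp hq h0 h1 (hpq x hx)
    · rw [indicator_of_notMem hx]
      have := div_nonneg (sq_nonneg (α * (q x - p x)))
        (mixture_pos hp hq h0 (by linarith) x).le
      linarith [mul_exp_tilt_le hp hq h0 h1 x]
  refine lintegral_ofReal_le_of_le hle
    (fun x => (mul_pos (hp x) (exp_pos _)).le.trans (hle x)) (hi1.sub hi2) ?_
  calc ∫ x, (p x + α * (q x - p x) / 2 - S.indicator (fun x => α / 24 * q x) x) ∂μ
      = 1 - α / 24 * ∫ x in S, q x ∂μ := by
        rw [integral_sub hi1 hi2, integral_indicator hS, integral_const_mul, integral_add hpi hi0,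
          integral_div, integral_const_mul, integral_sub hqi hpi, hp1, hq1]
        ring
    _ ≤ exp (-(α / 24 * ∫ x in S, q x ∂μ)) := one_sub_le_exp_neg _

end Integral

end Mixture

section Odds

/-- The part of the slab marginal `g` that comes from positive coefficients. -/
noncomputable def gPos (x : ℝ) : ℝ := ∫ u in Ioi 0, phi (x - u) * slab u

/-- The prior odds `(1 - α) / α` of the spike for which the posterior median has threshold `x`. -/
noncomputable def odds (x : ℝ) : ℝ := (gPos x - gPos (-x)) / phi x

theorem setIntegral_Iic_conv (x : ℝ) : ∫ u in Iic 0, phi (x - u) * slab u = gPos (-x) := by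
  have h := integral_comp_neg_Iic 0 (fun u => phi (-x - u) * slab u)
  rw [neg_zero] at h
  rw [gPos, ← h]
  refine integral_congr_ae (Eventually.of_forall fun u => ?_)
  simp only [slab_neg]
  rw [← phi_neg]
  ring_nf

theorem setIntegral_Ici_conv (x : ℝ) : ∫ u in Ici 0, phi (x - u) * slab u = gPos x :=
  integral_Ici_eq_integral_Ioi

theorem gPos_add_gPos_neg (x : ℝ) : gPos x + gPos (-x) = g x := by
  rw [← setIntegral_Iic_conv, gPos, g, add_comm]
  exact intervalIntegral.integral_Iic_add_Ioi (integrable_conv x).integrableOn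
    (integrable_conv x).integrableOn

theorem gPos_nonneg (x : ℝ) : 0 ≤ gPos x :=
  setIntegral_nonneg measurableSet_Ioi fun u _ => (mul_pos (phi_pos _) (slab_pos u)).le

theorem continuous_gPos : Continuous gPos := by
  refine continuous_of_dominated (bound := slab) (fun x => (integrable_conv x).1.restrict)
    (fun x => Eventually.of_forall fun u => ?_) integrable_slab.restrict
    (Eventually.of_forall fun u => ?_)
  · rw [norm_of_nonneg (mul_pos (phi_pos _) (slab_pos u)).le]
    exact mul_le_of_le_one_left (slab_pos u).le ((phi_le_half _).trans (by norm_num))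
  · exact (continuous_phi.comp (by fun_prop)).mul continuous_const

theorem continuous_odds : Continuous odds :=
  (continuous_gPos.sub (continuous_gPos.comp continuous_neg)).div continuous_phi
    fun x => (phi_pos x).ne'

theorem phi_sub (x u : ℝ) : phi (x - u) = phi x * exp (x * u) * exp (-u ^ 2 / 2) := by
  rw [phi_eq, phi_eq, mul_assoc, mul_assoc, ← exp_add, ← exp_add]
  ring_nf

theorem two_sinh_mul_eq (x u : ℝ) : 2 * sinh (x * u) * (exp (-u ^ 2 / 2) * slab u) =
    (phi (x - u) * slab u - phi (-x - u) * slab u) / phi x := by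
  have hφ := (phi_pos x).ne'
  rw [phi_sub x, phi_sub (-x), phi_neg, sinh_eq, neg_mul]
  field_simp

theorem integrableOn_two_sinh_mul (x : ℝ) :
    IntegrableOn (fun u => 2 * sinh (x * u) * (exp (-u ^ 2 / 2) * slab u)) (Ioi 0) := by
  simp only [two_sinh_mul_eq]
  exact ((integrable_conv x).sub (integrable_conv (-x))).integrableOn.div_const _

theorem odds_eq_integral (x : ℝ) :
    odds x = ∫ u in Ioi 0, 2 * sinh (x * u) * (exp (-u ^ 2 / 2) * slab u) := by
  simp only [two_sinh_mul_eq]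
  rw [integral_div, integral_sub (integrable_conv x).integrableOn
    (integrable_conv (-x)).integrableOn, odds, gPos, gPos]

theorem odds_strictMono : StrictMono odds := by
  intro x y hxy
  have hi := (integrableOn_two_sinh_mul y).sub (integrableOn_two_sinh_mul x)
  have hlt : ∀ u ∈ Ioi (0 : ℝ), 0 < 2 * sinh (y * u) * (exp (-u ^ 2 / 2) * slab u) -
      2 * sinh (x * u) * (exp (-u ^ 2 / 2) * slab u) := fun u hu => by
    have hsinh : sinh (x * u) < sinh (y * u) := sinh_lt_sinh.2 (mul_lt_mul_of_pos_right hxy hu)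
    rw [← sub_mul]
    exact mul_pos (by linarith) (mul_pos (exp_pos _) (slab_pos u))
  rw [← sub_pos, odds_eq_integral, odds_eq_integral,
    ← integral_sub (integrableOn_two_sinh_mul y) (integrableOn_two_sinh_mul x)]
  refine (setIntegral_pos_iff_support_of_nonneg_ae ?_ hi).2 ?_
  · filter_upwards [ae_restrict_mem measurableSet_Ioi] with u hu
    exact (hlt u hu).le
  · refine lt_of_lt_of_le ?_ (measure_mono (s := Ioi 0) fun u hu => ⟨(hlt u hu).ne', hu⟩)
    simp

theorem odds_zero : odds 0 = 0 := by simp [odds]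

theorem odds_nonneg {x : ℝ} (hx : 0 ≤ x) : 0 ≤ odds x := odds_zero ▸ odds_strictMono.monotone hx

theorem odds_le (x : ℝ) : odds x ≤ 6 * exp (x ^ 2 / 2) / (1 + x ^ 2) := by
  have hgap : gPos x - gPos (-x) ≤ 2 / (1 + x ^ 2) := by
    linarith [gPos_add_gPos_neg x, gPos_nonneg (-x), g_le x]
  have hexp : exp (x ^ 2 / 2) * exp (-x ^ 2 / 2) = 1 := by
    rw [neg_div, ← exp_add, add_neg_cancel, exp_zero]
  rw [odds, div_le_iff₀ (phi_pos x)]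
  calc gPos x - gPos (-x) ≤ 2 / (1 + x ^ 2) := hgap
    _ = 6 * exp (x ^ 2 / 2) / (1 + x ^ 2) * (1 / 3 * exp (-x ^ 2 / 2)) := by
        linear_combination -2 / (1 + x ^ 2) * hexp
    _ ≤ 6 * exp (x ^ 2 / 2) / (1 + x ^ 2) * phi x := by
        gcongr
        exact le_phi x

theorem phi_sub_eq_exp_mul (x u : ℝ) : phi (x - u) = exp (2 * (x * u)) * phi (-x - u) := by
  rw [phi_sub x, phi_sub (-x), phi_neg, two_mul, exp_add, neg_mul, exp_neg]
  field_simp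

theorem phi_neg_sub_le {x u : ℝ} (h : 0 ≤ x * u) : phi (-x - u) ≤ phi (x - u) := by
  rw [phi_sub_eq_exp_mul x]
  exact le_mul_of_one_le_left (phi_pos _).le (one_le_exp (by linarith))

theorem three_mul_phi_neg_sub_le {x u : ℝ} (h : 1 ≤ x * u) :
    3 * phi (-x - u) ≤ phi (x - u) := by
  rw [phi_sub_eq_exp_mul x]
  exact mul_le_mul_of_nonneg_right (by linarith [add_one_le_exp (2 * (x * u))]) (phi_pos _).le

theorem le_gPos_sub_gPos_neg {x : ℝ} (hx : 1 ≤ x) :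
    1 / 108 / (1 + x ^ 2) ≤ gPos x - gPos (-x) := by
  have hi := (integrable_conv x).sub (integrable_conv (-x))
  calc 1 / 108 / (1 + x ^ 2)
      = ∫ _ in Icc x (x + 1), 1 / 9 * (1 / 12 / (1 + x ^ 2)) := by
        rw [setIntegral_const, measureReal_def, volume_Icc, ENNReal.toReal_ofReal (by linarith),
          smul_eq_mul]
        ring
    _ ≤ ∫ u in Icc x (x + 1), (phi (x - u) * slab u - phi (-x - u) * slab u) := by
        refine setIntegral_mono_on (integrableOn_const (by simp)) hi.integrableOn
          measurableSet_Icc fun u hu => ?_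
        have hxu : (x - u) ^ 2 ≤ 1 := by nlinarith [hu.1, hu.2]
        have hφ : 1 / 9 ≤ phi (x - u) - phi (-x - u) := by
          linarith [one_sixth_le_phi hxu,
            three_mul_phi_neg_sub_le (x := x) (u := u) (by nlinarith [hu.1])]
        rw [← sub_mul]
        exact mul_le_mul hφ (le_slab_of_near hxu) (by positivity) (by linarith)
    _ ≤ ∫ u in Ioi 0, (phi (x - u) * slab u - phi (-x - u) * slab u) := by
        refine setIntegral_mono_set hi.integrableOn ?_
          (Eventually.of_forall fun u hu => lt_of_lt_of_le (by linarith) hu.1)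
        filter_upwards [ae_restrict_mem measurableSet_Ioi] with u hu
        have hφ := phi_neg_sub_le (mul_nonneg (by linarith) (le_of_lt hu) : 0 ≤ x * u)
        exact sub_nonneg.2 (mul_le_mul_of_nonneg_right hφ (slab_pos u).le)
    _ = gPos x - gPos (-x) :=
        integral_sub (integrable_conv x).integrableOn (integrable_conv (-x)).integrableOn

theorem le_odds {x : ℝ} (hx : 1 ≤ x) : exp (x ^ 2 / 2) / (54 * (1 + x ^ 2)) ≤ odds x := by
  have hexp : exp (x ^ 2 / 2) * exp (-x ^ 2 / 2) = 1 := by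
    rw [neg_div, ← exp_add, add_neg_cancel, exp_zero]
  rw [odds, le_div_iff₀ (phi_pos x)]
  calc exp (x ^ 2 / 2) / (54 * (1 + x ^ 2)) * phi x
      ≤ exp (x ^ 2 / 2) / (54 * (1 + x ^ 2)) * (1 / 2 * exp (-x ^ 2 / 2)) := by
        gcongr
        exact phi_le x
    _ = 1 / 108 / (1 + x ^ 2) * (exp (x ^ 2 / 2) * exp (-x ^ 2 / 2)) := by field_simp; norm_num
    _ = 1 / 108 / (1 + x ^ 2) := by rw [hexp, mul_one]
    _ ≤ gPos x - gPos (-x) := le_gPos_sub_gPos_neg hx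

theorem tendsto_odds_atTop : Tendsto odds atTop atTop := by
  refine tendsto_atTop_mono' atTop (f₁ := fun x => x / 3456) ?_
    (tendsto_id.atTop_div_const (by norm_num))
  filter_upwards [eventually_ge_atTop 1] with x hx
  refine le_trans ?_ (le_odds hx)
  have hexp : (1 + x ^ 2) ^ 2 ≤ 64 * exp (x ^ 2 / 2) := by
    refine (one_add_sq_le_exp (sq_nonneg x)).trans ?_
    gcongr
    norm_num
  rw [le_div_iff₀ (by positivity)]
  calc x / 3456 * (54 * (1 + x ^ 2)) = x * (1 + x ^ 2) / 64 := by ring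
    _ ≤ (1 + x ^ 2) * (1 + x ^ 2) / 64 := by
        gcongr
        nlinarith
    _ ≤ exp (x ^ 2 / 2) := by linarith

theorem odds_surjOn : SurjOn odds (Ici 0) (Ici 0) := by
  intro y hy
  obtain ⟨b, hyb, hb⟩ :=
    ((tendsto_odds_atTop.eventually_ge_atTop y).and (eventually_ge_atTop 0)).exists
  obtain ⟨t, ht, hty⟩ := intermediate_value_Icc hb continuous_odds.continuousOn
    ⟨odds_zero.trans_le hy, hyb⟩
  exact ⟨t, ht.1, hty⟩

end Odds

section Weight

variable {α β : ℝ}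

theorem weight_eq_mul_div_mixture (α x : ℝ) :
    weight α x = α * (g x / mixture phi g α x) := mul_div_assoc _ _ _

theorem weight_nonneg (h0 : 0 < α) (h1 : α ≤ 1) (x : ℝ) : 0 ≤ weight α x := by
  rw [weight_eq_mul_div_mixture]
  exact mul_nonneg h0.le (div_mixture_nonneg phi_pos g_pos h0 h1 x)

theorem one_sub_weight (h0 : 0 < α) (h1 : α ≤ 1) (x : ℝ) :
    1 - weight α x = (1 - α) * phi x / mixture phi g α x := by
  rw [weight_eq_mul_div_mixture, eq_div_iff (mixture_pos phi_pos g_pos h0 h1 x).ne', sub_mul,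
    mul_assoc, div_mul_cancel₀ _ (mixture_pos phi_pos g_pos h0 h1 x).ne', mixture]
  ring

theorem weight_le_one (h0 : 0 < α) (h1 : α ≤ 1) (x : ℝ) : weight α x ≤ 1 := by
  rw [← sub_nonneg, one_sub_weight h0 h1]
  exact div_nonneg (mul_nonneg (sub_nonneg.2 h1) (phi_pos x).le)
    (mixture_pos phi_pos g_pos h0 h1 x).le

theorem weight_mono (h0 : 0 < α) (h : α ≤ β) (h1 : β ≤ 1) (x : ℝ) :
    weight α x ≤ weight β x := by
  rw [weight, weight]
  refine (div_le_div_iff₀ (mixture_pos phi_pos g_pos h0 (h.trans h1) x)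
    (mixture_pos phi_pos g_pos (h0.trans_le h) h1 x)).2 ?_
  rw [mixture, mixture]
  linarith [mul_nonneg (sub_nonneg.2 h) (mul_pos (phi_pos x) (g_pos x)).le]

end Weight

section Median

variable {α : ℝ}

theorem slabPosterior_apply (x : ℝ) {s : Set ℝ} (hs : MeasurableSet s) :
    slabPosterior x s = ENNReal.ofReal ((∫ u in s, phi (x - u) * slab u) / g x) := by
  rw [slabPosterior, withDensity_apply _ hs, ← integral_div,
    ofReal_integral_eq_lintegral_ofReal ((integrable_conv x).integrableOn.div_const _)]
  exact Eventually.of_forall fun u =>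
    div_nonneg (mul_pos (phi_pos _) (slab_pos u)).le (g_pos x).le

instance isProbabilityMeasure_slabPosterior (x : ℝ) : IsProbabilityMeasure (slabPosterior x) := by
  refine ⟨?_⟩
  rw [slabPosterior_apply x MeasurableSet.univ, setIntegral_univ, ← g, div_self (g_pos x).ne',
    ENNReal.ofReal_one]

theorem isProbabilityMeasure_coordPosterior (h0 : 0 < α) (h1 : α ≤ 1) (x : ℝ) :
    IsProbabilityMeasure (coordPosterior α x) := by
  refine ⟨?_⟩
  simp only [coordPosterior, Measure.add_apply, Measure.smul_apply, measure_univ, smul_eq_mul,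
    mul_one]
  rw [← ENNReal.ofReal_add (sub_nonneg.2 (weight_le_one h0 h1 x)) (weight_nonneg h0 h1 x),
    sub_add_cancel, ENNReal.ofReal_one]

theorem coordPosterior_apply_of_zero_mem (h0 : 0 < α) (h1 : α ≤ 1) (x : ℝ) {s : Set ℝ}
    (hs : MeasurableSet s) (hs0 : (0 : ℝ) ∈ s) :
    coordPosterior α x s = ENNReal.ofReal
      (((1 - α) * phi x + α * ∫ u in s, phi (x - u) * slab u) / mixture phi g α x) := by
  have hg := (g_pos x).ne'
  have hm := (mixture_pos phi_pos g_pos h0 h1 x).ne'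
  have hw := weight_nonneg h0 h1 x
  have hI : 0 ≤ (∫ u in s, phi (x - u) * slab u) / g x :=
    div_nonneg (setIntegral_nonneg hs fun u _ => (mul_pos (phi_pos _) (slab_pos u)).le)
      (g_pos x).le
  simp only [coordPosterior, Measure.add_apply, Measure.smul_apply, smul_eq_mul,
    Measure.dirac_apply' _ hs, indicator_of_mem hs0, Pi.one_apply, mul_one,
    slabPosterior_apply x hs]
  rw [← ENNReal.ofReal_mul hw, ← ENNReal.ofReal_add (sub_nonneg.2 (weight_le_one h0 h1 x))
    (mul_nonneg hw hI), one_sub_weight h0 h1, weight_eq_mul_div_mixture]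
  congr 1
  field_simp

theorem half_le_coordPosterior_iff (h0 : 0 < α) (h1 : α ≤ 1) (x : ℝ) {s : Set ℝ}
    (hs : MeasurableSet s) (hs0 : (0 : ℝ) ∈ s) :
    1 / 2 ≤ coordPosterior α x s ↔
      α * (g x - 2 * ∫ u in s, phi (x - u) * slab u) ≤ (1 - α) * phi x := by
  have hhalf : (1 / 2 : ℝ≥0∞) = ENNReal.ofReal (1 / 2) := by
    rw [ENNReal.ofReal_div_of_pos (by norm_num)]
    simp
  rw [coordPosterior_apply_of_zero_mem h0 h1 x hs hs0, hhalf, ENNReal.ofReal_le_ofReal_iff',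
    or_iff_left (by norm_num), le_div_iff₀ (mixture_pos phi_pos g_pos h0 h1 x), mixture]
  constructor <;> intro h <;> linarith

theorem isMedian_zero_iff (h0 : 0 < α) (h1 : α ≤ 1) {x : ℝ} (hx : 0 ≤ x) :
    IsMedian (coordPosterior α x) 0 ↔ α * odds x ≤ 1 - α := by
  have hφ := phi_pos x
  have hodds := odds_nonneg hx
  have hgap : gPos x - gPos (-x) = odds x * phi x := by rw [odds, div_mul_cancel₀ _ hφ.ne']
  rw [IsMedian, half_le_coordPosterior_iff h0 h1 x measurableSet_Iic (by simp),
    half_le_coordPosterior_iff h0 h1 x measurableSet_Ici (by simp), setIntegral_Iic_conv,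
    setIntegral_Ici_conv, ← gPos_add_gPos_neg,
    show gPos x + gPos (-x) - 2 * gPos (-x) = odds x * phi x by linarith,
    show gPos x + gPos (-x) - 2 * gPos x = -(odds x * phi x) by linarith,
    ← mul_assoc, mul_le_mul_iff_left₀ hφ]
  refine and_iff_left_of_imp fun _ => ?_
  have hspike : 0 ≤ (1 - α) * phi x := mul_nonneg (sub_nonneg.2 h1) hφ.le
  have hslab : 0 ≤ α * (odds x * phi x) := by positivity
  linarith

end Median

section Threshold

variable {α t : ℝ}

/-- The prior weight whose threshold is `t`. -/
noncomputable def weightOf (t : ℝ) : ℝ := 1 / (1 + odds t)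

theorem weightOf_mem_Ioc (ht : 0 ≤ t) : weightOf t ∈ Ioc 0 1 := by
  have := odds_nonneg ht
  refine ⟨by unfold weightOf; positivity, ?_⟩
  rw [weightOf, div_le_one (by positivity)]
  linarith

theorem weightOf_strictAntiOn : StrictAntiOn weightOf (Ici 0) := by
  intro s hs t _ hst
  have := odds_strictMono hst
  have := odds_nonneg (mem_Ici.1 hs)
  unfold weightOf
  gcongr

theorem weightOf_mul_odds (ht : 0 ≤ t) : weightOf t * odds t = 1 - weightOf t := by
  have := odds_nonneg ht
  unfold weightOf
  field_simp
  ring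

theorem weightOf_surjOn : SurjOn weightOf (Ici 0) (Ioc 0 1) := by
  intro α hα
  obtain ⟨t, ht, hodds⟩ := odds_surjOn (mem_Ici.2 (sub_nonneg.2 (one_le_one_div hα.1 hα.2)))
  refine ⟨t, ht, ?_⟩
  rw [weightOf, hodds, add_sub_cancel, one_div_one_div]

theorem threshold_weightOf (ht : 0 ≤ t) : threshold (weightOf t) = t := by
  obtain ⟨h0, h1⟩ := weightOf_mem_Ioc ht
  have hset : {x : ℝ | 0 ≤ x ∧ IsMedian (coordPosterior (weightOf t) x) 0} = Icc 0 t := by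
    ext x
    refine and_congr_right fun hx => ?_
    rw [isMedian_zero_iff h0 h1 hx, ← weightOf_mul_odds ht, mul_le_mul_iff_right₀ h0,
      odds_strictMono.le_iff_le]
  rw [threshold, hset, csSup_Icc ht]

theorem thresholdInv_eq_weightOf (ht : 0 ≤ t) : thresholdInv t = weightOf t := by
  have hex : ∃ α ∈ Ioc (0 : ℝ) 1, threshold α = t :=
    ⟨weightOf t, weightOf_mem_Ioc ht, threshold_weightOf ht⟩
  have hinv : threshold (thresholdInv t) = t := Function.invFunOn_eq hex
  have hmem : thresholdInv t ∈ Ioc (0 : ℝ) 1 := Function.invFunOn_mem hex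
  obtain ⟨s, hs, hsα⟩ := weightOf_surjOn hmem
  rw [← hsα, threshold_weightOf hs] at hinv
  rw [← hsα, hinv]

theorem threshold_le_iff (h0 : 0 < α) (h1 : α ≤ 1) (ht : 0 ≤ t) :
    threshold α ≤ t ↔ weightOf t ≤ α := by
  obtain ⟨s, hs, rfl⟩ := weightOf_surjOn ⟨h0, h1⟩
  rw [threshold_weightOf hs, weightOf_strictAntiOn.le_iff_ge ht hs]

theorem weightOf_le (ht : 1 ≤ t) : weightOf t ≤ 54 * (1 + t ^ 2) * exp (-t ^ 2 / 2) :=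
  calc weightOf t ≤ 1 / odds t :=
        one_div_le_one_div_of_le (lt_of_lt_of_le (by positivity) (le_odds ht)) (by linarith)
    _ ≤ 1 / (exp (t ^ 2 / 2) / (54 * (1 + t ^ 2))) :=
        one_div_le_one_div_of_le (by positivity) (le_odds ht)
    _ = 54 * (1 + t ^ 2) * exp (-t ^ 2 / 2) := by
        rw [neg_div, exp_neg]
        field_simp

theorem le_weightOf (ht : 0 ≤ t) : 1 / (1 + 6 * exp (t ^ 2 / 2) / (1 + t ^ 2)) ≤ weightOf t :=
  one_div_le_one_div_of_le (by linarith [odds_nonneg ht]) (by linarith [odds_le t])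

end Threshold

section PosteriorLoss

variable {α : ℝ}

theorem lintegral_sq_sub_slabPosterior_self_le (x : ℝ) :
    ∫⁻ u, ENNReal.ofReal ((u - x) ^ 2) ∂slabPosterior x ≤ ENNReal.ofReal 96 := by
  have hg := g_pos x
  have hdens : Measurable fun u => ENNReal.ofReal (phi (x - u) * slab u / g x) :=
    ((((continuous_phi.comp (continuous_const.sub continuous_id)).mul
      continuous_slab).div_const _).measurable).ennreal_ofReal
  have hmul : (fun u => ENNReal.ofReal (phi (x - u) * slab u / g x)) *
      (fun u => ENNReal.ofReal ((u - x) ^ 2)) =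
      fun u => ENNReal.ofReal ((u - x) ^ 2 * (phi (x - u) * slab u) / g x) := by
    ext u
    rw [Pi.mul_apply, mul_comm, ← ENNReal.ofReal_mul (sq_nonneg _), ← mul_div_assoc]
  rw [slabPosterior, lintegral_withDensity_eq_lintegral_mul _ hdens (by fun_prop), hmul]
  refine lintegral_ofReal_le_of_le le_rfl (fun u => ?_) ((integrable_sq_mul_conv x).div_const _) ?_
  · exact div_nonneg (mul_nonneg (sq_nonneg _) (mul_pos (phi_pos _) (slab_pos u)).le) hg.le
  rw [integral_div, div_le_iff₀ hg]
  calc ∫ u, (u - x) ^ 2 * (phi (x - u) * slab u) ≤ 8 / 3 / (1 + x ^ 2) := integral_sq_mul_conv_le x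
    _ = 96 * (1 / 36 / (1 + x ^ 2)) := by ring
    _ ≤ 96 * g x := mul_le_mul_of_nonneg_left (le_g x) (by norm_num)

theorem lintegral_sq_sub_slabPosterior_le (θ x : ℝ) :
    ∫⁻ u, ENNReal.ofReal ((u - θ) ^ 2) ∂slabPosterior x ≤
      ENNReal.ofReal (2 * (x - θ) ^ 2 + 192) :=
  calc ∫⁻ u, ENNReal.ofReal ((u - θ) ^ 2) ∂slabPosterior x
      ≤ ∫⁻ u, (ENNReal.ofReal 2 * ENNReal.ofReal ((u - x) ^ 2) +
          ENNReal.ofReal (2 * (x - θ) ^ 2)) ∂slabPosterior x := by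
        refine lintegral_mono fun u => ?_
        rw [← ENNReal.ofReal_mul (by norm_num), ← ENNReal.ofReal_add (by positivity)
          (by positivity)]
        refine ENNReal.ofReal_le_ofReal ?_
        linarith [sq_nonneg (u - x - (x - θ))]
    _ ≤ ENNReal.ofReal 2 * ENNReal.ofReal 96 + ENNReal.ofReal (2 * (x - θ) ^ 2) := by
        rw [lintegral_add_right _ measurable_const, lintegral_const_mul _ (by fun_prop),
          lintegral_const, measure_univ, mul_one]
        gcongr
        exact lintegral_sq_sub_slabPosterior_self_le x
    _ = ENNReal.ofReal (2 * (x - θ) ^ 2 + 192) := by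
        rw [← ENNReal.ofReal_mul (by norm_num), ← ENNReal.ofReal_add (by norm_num)
          (by positivity)]
        ring_nf

theorem lintegral_sq_sub_coordPosterior_le (h0 : 0 < α) (h1 : α ≤ 1) (θ x : ℝ) :
    ∫⁻ u, ENNReal.ofReal ((u - θ) ^ 2) ∂coordPosterior α x ≤
      ENNReal.ofReal ((1 - weight α x) * θ ^ 2 + weight α x * (2 * (x - θ) ^ 2 + 192)) := by
  have hw := weight_nonneg h0 h1 x
  have hw' : 0 ≤ 1 - weight α x := sub_nonneg.2 (weight_le_one h0 h1 x)
  rw [coordPosterior, lintegral_add_measure, lintegral_smul_measure, lintegral_smul_measure,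
    lintegral_dirac, smul_eq_mul, smul_eq_mul, zero_sub, neg_sq,
    ENNReal.ofReal_add (by positivity) (by positivity), ENNReal.ofReal_mul hw',
    ENNReal.ofReal_mul hw]
  gcongr
  exact lintegral_sq_sub_slabPosterior_le θ x

theorem lintegral_pi_eval {ι : Type*} [Fintype ι] {Ω : ι → Type*} [∀ i, MeasurableSpace (Ω i)]
    (μ : ∀ i, Measure (Ω i)) [∀ i, IsProbabilityMeasure (μ i)] (i : ι) {f : Ω i → ℝ≥0∞}
    (hf : Measurable f) : ∫⁻ x, f (x i) ∂Measure.pi μ = ∫⁻ u, f u ∂μ i :=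
  (measurePreserving_eval μ i).lintegral_comp hf

theorem posteriorLoss_le {n : ℕ} (h0 : 0 < α) (h1 : α ≤ 1) (θ X : Fin n → ℝ) :
    posteriorLoss α θ X ≤ ENNReal.ofReal (∑ i, ((1 - weight α (X i)) * θ i ^ 2 +
      weight α (X i) * (2 * (X i - θ i) ^ 2 + 192))) := by
  have hp : ∀ i, IsProbabilityMeasure (coordPosterior α (X i)) := fun i =>
    isProbabilityMeasure_coordPosterior h0 h1 _
  simp only [posteriorLoss, posterior, ENNReal.ofReal_sum_of_nonneg fun _ _ => sq_nonneg _]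
  rw [lintegral_finsetSum _ fun _ _ => by fun_prop, ENNReal.ofReal_sum_of_nonneg]
  · refine Finset.sum_le_sum fun i _ => ?_
    rw [lintegral_pi_eval (fun i => coordPosterior α (X i)) i
      (f := fun u => ENNReal.ofReal ((u - θ i) ^ 2)) (by fun_prop)]
    exact lintegral_sq_sub_coordPosterior_le h0 h1 _ _
  · intro i _
    have hw := weight_nonneg h0 h1 (X i)
    have hw' := sub_nonneg.2 (weight_le_one h0 h1 (X i))
    positivity

end PosteriorLoss

section Signal

variable {α β b B : ℝ}

theorem one_sub_weight_mul_sq_le_sq (h0 : 0 < α) (h1 : α ≤ 1) (x : ℝ) :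
    (1 - weight α x) * x ^ 2 ≤ x ^ 2 :=
  mul_le_of_le_one_left (sq_nonneg x) (by linarith [weight_nonneg h0 h1 x])

theorem one_sub_weight_mul_sq_le_exp_mul (h0 : 0 < α) (h1 : α ≤ 1) (x : ℝ) :
    (1 - weight α x) * x ^ 2 ≤ 1152 * exp (-x ^ 2 / 4) * (g x / mixture phi g α x) := by
  have hm := mixture_pos phi_pos g_pos h0 h1 x
  have hφ := phi_pos x
  rw [one_sub_weight h0 h1, div_mul_eq_mul_div, ← mul_div_assoc]
  refine div_le_div_of_nonneg_right ?_ hm.le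
  calc (1 - α) * phi x * x ^ 2 ≤ 1 * phi x * (1 + x ^ 2) := by gcongr <;> linarith
    _ = (1 + x ^ 2) * phi x := by ring
    _ ≤ 1152 * exp (-x ^ 2 / 4) * g x := one_add_sq_mul_phi_le_exp_mul_g x

theorem one_sub_weight_mul_sq_le_add (h0 : 0 < α) (h1 : α ≤ 1) (hb : 0 ≤ b) (x : ℝ) :
    (1 - weight α x) * x ^ 2 ≤ b + 1152 * exp (-b / 4) * (g x / mixture phi g α x) := by
  have hq := div_mixture_nonneg phi_pos g_pos h0 h1 x
  rcases le_or_gt (x ^ 2) b with hx | hx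
  · have : 0 ≤ 1152 * exp (-b / 4) * (g x / mixture phi g α x) := by positivity
    linarith [one_sub_weight_mul_sq_le_sq h0 h1 x]
  · calc (1 - weight α x) * x ^ 2 ≤ 1152 * exp (-x ^ 2 / 4) * (g x / mixture phi g α x) :=
          one_sub_weight_mul_sq_le_exp_mul h0 h1 x
      _ ≤ 1152 * exp (-b / 4) * (g x / mixture phi g α x) := by gcongr
      _ ≤ b + 1152 * exp (-b / 4) * (g x / mixture phi g α x) := le_add_of_nonneg_left hb

theorem one_sub_weight_mul_sq_le_add_one (h0 : 0 < α) (h1 : α ≤ 1) (hB0 : 0 ≤ B)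
    (hB : 1152 * exp (-B / 4) ≤ α) (x : ℝ) : (1 - weight α x) * x ^ 2 ≤ B + 1 :=
  calc (1 - weight α x) * x ^ 2
      ≤ B + 1152 * exp (-B / 4) * (g x / mixture phi g α x) :=
        one_sub_weight_mul_sq_le_add h0 h1 hB0 x
    _ ≤ B + α * (1 / α) := add_le_add_right (mul_le_mul hB (div_mixture_le phi_pos g_pos h0 h1 x)
        (div_mixture_nonneg phi_pos g_pos h0 h1 x) h0.le) B
    _ = B + 1 := by rw [mul_one_div_cancel h0.ne']

-- The posterior weight is that of `α`, but the bound is by the likelihood equation for `β`: where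
-- the spike dominates the `β`-mixture the loss is at most `x ^ 2`, elsewhere it is at most `B + 1`.
theorem one_sub_weight_mul_sq_le_add_of_mul_le (h0 : 0 < α) (h1 : α ≤ 1) (hB0 : 0 ≤ B)
    (hB : 1152 * exp (-B / 4) ≤ α) (hβ0 : 0 < β) (hβ1 : β ≤ 1) (hb : 0 ≤ b)
    (hβ : (B + 1) * β ≤ 1152 * exp (-b / 4)) (x : ℝ) :
    (1 - weight α x) * x ^ 2 ≤ b + 2304 * exp (-b / 4) * (g x / mixture phi g β x) := by
  have hm := mixture_pos phi_pos g_pos hβ0 hβ1 x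
  have hg := g_pos x
  have hφ := phi_pos x
  rcases le_or_gt (x ^ 2) b with hx | hx
  · exact (one_sub_weight_mul_sq_le_sq h0 h1 x).trans (hx.trans
      (le_add_of_nonneg_right (mul_nonneg (by positivity) (div_nonneg hg.le hm.le))))
  refine le_add_of_nonneg_of_le hb ?_
  rw [← mul_div_assoc, le_div_iff₀ hm]
  have hspike : (1 - β) * phi x ≤ phi x := mul_le_of_le_one_left hφ.le (by linarith)
  rcases le_or_gt (β * g x) (phi x) with hc | hc
  · calc (1 - weight α x) * x ^ 2 * mixture phi g β x ≤ (1 + x ^ 2) * (2 * phi x) := by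
          gcongr
          · linarith [one_sub_weight_mul_sq_le_sq h0 h1 x]
          · rw [mixture]
            linarith
      _ = 2 * ((1 + x ^ 2) * phi x) := by ring
      _ ≤ 2 * (1152 * exp (-b / 4) * g x) := by
          grw [one_add_sq_mul_phi_le_exp_mul_g x]
          gcongr
      _ = 2304 * exp (-b / 4) * g x := by ring
  · calc (1 - weight α x) * x ^ 2 * mixture phi g β x ≤ (B + 1) * (2 * (β * g x)) := by
          gcongr
          · exact one_sub_weight_mul_sq_le_add_one h0 h1 hB0 hB x
          · rw [mixture]
            linarith
      _ = 2 * ((B + 1) * β) * g x := by ring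
      _ ≤ 2 * (1152 * exp (-b / 4)) * g x := by gcongr
      _ = 2304 * exp (-b / 4) * g x := by ring

end Signal

section Noise

variable {α z : ℝ}

theorem lintegral_gaussianReal_le (f : ℝ → ℝ) :
    ∫⁻ x, ENNReal.ofReal (f x) ∂gaussianReal 0 1 ≤ ∫⁻ x, ENNReal.ofReal (phi x * f x) := by
  rw [gaussianReal_of_var_ne_zero _ one_ne_zero]
  refine (lintegral_withDensity_le_lintegral_mul _ (measurable_gaussianPDF 0 1) _).trans_eq ?_
  simp only [Pi.mul_apply, gaussianPDF, ← ENNReal.ofReal_mul (gaussianPDFReal_nonneg _ _ _), phi]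

theorem integral_exp_neg_sq_div_eight_le : ∫ x : ℝ, exp (-(1 / 8) * x ^ 2) ≤ 6 := by
  rw [integral_gaussian]
  refine sqrt_le_iff.2 ⟨by norm_num, ?_⟩
  rw [div_le_iff₀ (by norm_num)]
  linarith [pi_le_four]

theorem phi_mul_noise_le (h0 : 0 < α) (h1 : α ≤ 1 / 2) (x : ℝ) :
    phi x * ((1 + x ^ 2) * weight α x) ≤ 4 * α :=
  calc phi x * ((1 + x ^ 2) * weight α x)
      = (1 + x ^ 2) * (α * (phi x * (g x / mixture phi g α x))) := by
        rw [weight_eq_mul_div_mixture]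
        ring
    _ ≤ (1 + x ^ 2) * (α * (2 * g x)) :=
        mul_le_mul_of_nonneg_left (mul_le_mul_of_nonneg_left
          (mul_div_mixture_le phi_pos g_pos h0 h1 x) h0.le) (by positivity)
    _ ≤ (1 + x ^ 2) * (α * (2 * (2 / (1 + x ^ 2)))) := by
        gcongr
        exact g_le x
    _ = 4 * α := by
        field_simp
        ring

theorem one_add_sq_mul_exp_neg_le (x : ℝ) : (1 + x ^ 2) * exp (-(1 / 8) * x ^ 2) ≤ 8 := by
  have hexp : exp (-(1 / 8) * x ^ 2) = (exp (x ^ 2 / 8))⁻¹ := by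
    rw [← exp_neg]
    ring_nf
  rw [hexp, ← div_eq_mul_inv, div_le_iff₀ (exp_pos _)]
  linarith [add_one_le_exp (x ^ 2 / 8)]

theorem phi_mul_noise_le_of_sq_le (h0 : 0 < α) (h1 : α ≤ 1) {x : ℝ} (hx : z ^ 2 ≤ x ^ 2) :
    phi x * ((1 + x ^ 2) * weight α x) ≤
      4 * exp (-z ^ 2 / 4) * exp (-(1 / 8) * x ^ 2) := by
  have hsplit : exp (-x ^ 2 / 2) =
      exp (-x ^ 2 / 4) * (exp (-(1 / 8) * x ^ 2) * exp (-(1 / 8) * x ^ 2)) := by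
    rw [← exp_add, ← exp_add]
    ring_nf
  calc phi x * ((1 + x ^ 2) * weight α x)
      ≤ 1 / 2 * exp (-x ^ 2 / 2) * ((1 + x ^ 2) * 1) := by
        gcongr
        · exact mul_nonneg (by positivity) (weight_nonneg h0 h1 x)
        · exact phi_le x
        · exact weight_le_one h0 h1 x
    _ = 1 / 2 * exp (-x ^ 2 / 4) * exp (-(1 / 8) * x ^ 2) *
          ((1 + x ^ 2) * exp (-(1 / 8) * x ^ 2)) := by
        rw [hsplit]
        ring
    _ ≤ 1 / 2 * exp (-z ^ 2 / 4) * exp (-(1 / 8) * x ^ 2) * 8 := by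
        gcongr
        exact one_add_sq_mul_exp_neg_le x
    _ = 4 * exp (-z ^ 2 / 4) * exp (-(1 / 8) * x ^ 2) := by ring

theorem lintegral_noise_le (h0 : 0 < α) (h1 : α ≤ 1 / 2) (hz : 0 ≤ z) :
    ∫⁻ x, ENNReal.ofReal ((1 + x ^ 2) * weight α x) ∂gaussianReal 0 1 ≤
      ENNReal.ofReal (8 * α * z + 24 * exp (-z ^ 2 / 4)) := by
  have hi1 : Integrable ((Icc (-z) z).indicator fun _ : ℝ => 4 * α) :=
    (integrable_indicator_iff measurableSet_Icc).2 (integrableOn_const (by simp))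
  have hi2 : Integrable fun x : ℝ => 4 * exp (-z ^ 2 / 4) * exp (-(1 / 8) * x ^ 2) :=
    (integrable_exp_neg_mul_sq (by norm_num)).const_mul _
  refine (lintegral_gaussianReal_le _).trans
    (lintegral_ofReal_le_of_le (fun x => ?_) (fun x => ?_) (hi1.add hi2) ?_)
  · rw [Pi.add_apply]
    by_cases hx : x ∈ Icc (-z) z
    · rw [indicator_of_mem hx]
      exact (phi_mul_noise_le h0 h1 x).trans (le_add_of_nonneg_right (by positivity))
    · rw [indicator_of_notMem hx, zero_add]
      refine phi_mul_noise_le_of_sq_le h0 (by linarith) ?_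
      rw [sq_le_sq, abs_of_nonneg hz]
      exact (not_le.1 fun h => hx (abs_le.1 h)).le
  · exact add_nonneg (indicator_nonneg (fun _ _ => by positivity) x) (by positivity)
  · calc ∫ x, ((Icc (-z) z).indicator (fun _ : ℝ => 4 * α) +
          fun x : ℝ => 4 * exp (-z ^ 2 / 4) * exp (-(1 / 8) * x ^ 2)) x
        = 8 * α * z + 4 * exp (-z ^ 2 / 4) * ∫ x : ℝ, exp (-(1 / 8) * x ^ 2) := by
          rw [integral_add' hi1 hi2, integral_indicator_const _ measurableSet_Icc,
            integral_const_mul, volume_real_Icc_of_le (by linarith), smul_eq_mul]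
          ring
      _ ≤ 8 * α * z + 4 * exp (-z ^ 2 / 4) * 6 := by
          gcongr
          exact integral_exp_neg_sq_div_eight_le
      _ = 8 * α * z + 24 * exp (-z ^ 2 / 4) := by ring

end Noise

section Chernoff

variable {α z : ℝ}

theorem measurable_tilt (α : ℝ) : Measurable (tilt phi g α) := by
  have hφ := continuous_phi.measurable
  have hg := continuous_g.measurable
  unfold tilt mixture
  fun_prop

theorem le_setIntegral_g (hz : 1 ≤ z) : 1 / (72 * z) ≤ ∫ x in Ioi z, g x := by
  have hz0 : 0 < z := by linarith
  calc 1 / (72 * z) = ∫ x in Ioi z, 1 / 72 * x ^ (-2 : ℝ) := by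
        rw [integral_const_mul, integral_Ioi_rpow_of_lt (by norm_num) hz0]
        norm_num [rpow_neg hz0.le]
        ring
    _ ≤ ∫ x in Ioi z, g x := by
        refine setIntegral_mono_on
          ((integrableOn_Ioi_rpow_of_lt (by norm_num) hz0).const_mul _)
          integrable_g.integrableOn measurableSet_Ioi fun x hx => ?_
        have hx1 : 1 < x := lt_of_le_of_lt hz hx
        refine le_trans ?_ (le_g x)
        rw [rpow_neg (by linarith), rpow_two, div_div, ← div_eq_mul_inv, div_div]
        exact one_div_le_one_div_of_le (by positivity) (by nlinarith)

theorem lintegral_exp_tilt_le (h0 : 0 < α) (h1 : α ≤ 1 / 4) (hz : 1 ≤ z)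
    (hαz : 2304 * exp (-z ^ 2 / 4) ≤ α) :
    ∫⁻ x, ENNReal.ofReal (exp (tilt phi g α x)) ∂gaussianReal 0 1 ≤
      ENNReal.ofReal (exp (-(α / (1728 * z)))) := by
  have hspike : ∀ x ∈ Ioi z, 2 * phi x ≤ α * g x := by
    intro x hx
    have hsq : z ^ 2 ≤ x ^ 2 := by
      have := mem_Ioi.1 hx
      gcongr
    calc 2 * phi x ≤ 2 * (1152 * exp (-x ^ 2 / 4) * g x) := by
          gcongr
          exact phi_le_exp_mul_g x
      _ = 2304 * exp (-x ^ 2 / 4) * g x := by ring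
      _ ≤ 2304 * exp (-z ^ 2 / 4) * g x := by
          have := (g_pos x).le
          gcongr
      _ ≤ α * g x := mul_le_mul_of_nonneg_right hαz (g_pos x).le
  calc ∫⁻ x, ENNReal.ofReal (exp (tilt phi g α x)) ∂gaussianReal 0 1
      ≤ ∫⁻ x, ENNReal.ofReal (phi x * exp (tilt phi g α x)) := lintegral_gaussianReal_le _
    _ ≤ ENNReal.ofReal (exp (-(α / 24 * ∫ x in Ioi z, g x))) :=
        lintegral_mul_exp_tilt_le phi_pos g_pos integrable_phi integrable_g integral_phi
          integral_g h0 h1 measurableSet_Ioi hspike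
    _ ≤ ENNReal.ofReal (exp (-(α / 24 * (1 / (72 * z))))) := by
        gcongr
        exact le_setIntegral_g hz
    _ = ENNReal.ofReal (exp (-(α / (1728 * z)))) := by
        rw [div_mul_div_comm, mul_one, ← mul_assoc]
        norm_num

theorem lintegral_sq_mul_exp_tilt_le (h0 : 0 < α) (h1 : α ≤ 1) :
    ∫⁻ x, ENNReal.ofReal ((1 + x ^ 2) * exp (tilt phi g α x)) ∂gaussianReal 0 1 ≤
      ENNReal.ofReal 4 := by
  refine (lintegral_gaussianReal_le _).trans
    (lintegral_ofReal_le_of_le (h := fun x => 2 * (phi x + x ^ 2 * phi x)) (fun x => ?_)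
    (fun x => ?_) ((integrable_phi.add (integrable_pow_mul_phi 2)).const_mul _) ?_)
  · have := (phi_pos x).le
    calc phi x * ((1 + x ^ 2) * exp (tilt phi g α x)) ≤ phi x * ((1 + x ^ 2) * 2) := by
          gcongr
          exact exp_tilt_le_two phi_pos g_pos h0 h1 x
      _ = 2 * (phi x + x ^ 2 * phi x) := by ring
  · have := (phi_pos x).le
    positivity
  · rw [integral_const_mul, integral_add integrable_phi (integrable_pow_mul_phi 2), integral_phi,
      integral_sq_mul_phi]
    norm_num

theorem one_le_prod_exp_tilt {n : ℕ} {X : Fin n → ℝ} (h0 : 0 ≤ α)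
    (h : 0 ≤ score phi g X α) : 1 ≤ ∏ j, ENNReal.ofReal (exp (tilt phi g α (X j))) := by
  rw [← ENNReal.ofReal_prod_of_nonneg fun _ _ => (exp_pos _).le, ← exp_sum,
    ENNReal.one_le_ofReal, one_le_exp_iff, sum_tilt]
  positivity

end Chernoff

section ProductMeasure

theorem lintegral_pi_prod {ι : Type*} [Fintype ι] {Ω : ι → Type*} [∀ i, MeasurableSpace (Ω i)]
    (μ : ∀ i, Measure (Ω i)) [∀ i, IsProbabilityMeasure (μ i)] {f : ∀ i, Ω i → ℝ≥0∞}
    (hf : ∀ i, Measurable (f i)) :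
    ∫⁻ x, ∏ i, f i (x i) ∂Measure.pi μ = ∏ i, ∫⁻ u, f i u ∂μ i := by
  refine (lintegral_prod_eq_prod_lintegral_of_indepFun (μ := Measure.pi μ) Finset.univ
    (fun i (x : ∀ i, Ω i) => f i (x i)) (iIndepFun_pi fun i => (hf i).aemeasurable)
    fun i => (hf i).comp (measurable_pi_apply i)).trans ?_
  exact Finset.prod_congr rfl fun i _ => lintegral_pi_eval μ i (hf i)

variable {ι Ω : Type*} [Fintype ι] [MeasurableSpace Ω]

theorem lintegral_pi_mul_prod [DecidableEq ι] (μ : ι → Measure Ω) [∀ i, IsProbabilityMeasure (μ i)]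
    {u v : Ω → ℝ≥0∞} (hu : Measurable u) (hv : Measurable v) (i : ι) :
    ∫⁻ x, u (x i) * ∏ j, v (x j) ∂Measure.pi μ =
      (∫⁻ y, u y * v y ∂μ i) * ∏ j ∈ Finset.univ.erase i, ∫⁻ y, v y ∂μ j := by
  have hmeas : ∀ j, Measurable (Function.update (fun _ => v) i (u * v) j) := by
    intro j
    rcases eq_or_ne j i with rfl | hj
    · simpa only [Function.update_self] using hu.mul hv
    · simpa only [Function.update_of_ne hj] using hv
  have hprod : ∀ x : ι → Ω, u (x i) * ∏ j, v (x j) =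
      ∏ j, Function.update (fun _ => v) i (u * v) j (x j) := by
    intro x
    rw [← Finset.mul_prod_erase _ _ (Finset.mem_univ i), ← mul_assoc,
      ← Finset.mul_prod_erase _ (fun j => Function.update (fun _ => v) i (u * v) j (x j))
        (Finset.mem_univ i), Function.update_self, Pi.mul_apply]
    congr 1
    refine Finset.prod_congr rfl fun j hj => ?_
    rw [Function.update_of_ne (Finset.ne_of_mem_erase hj)]
  simp only [hprod]
  rw [lintegral_pi_prod μ hmeas, ← Finset.mul_prod_erase _ _ (Finset.mem_univ i),
    Function.update_self]
  refine congrArg₂ _ rfl (Finset.prod_congr rfl fun j hj => ?_)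
  rw [Function.update_of_ne (Finset.ne_of_mem_erase hj)]

instance isProbabilityMeasure_dataLaw {n : ℕ} (θ : Fin n → ℝ) :
    IsProbabilityMeasure (dataLaw θ) := by
  unfold dataLaw
  infer_instance

end ProductMeasure

section NoiseUnderTilt

variable {n : ℕ} {θ : Fin n → ℝ} {T : Finset (Fin n)} {α z : ℝ}

theorem prod_lintegral_exp_tilt_le (hT : ∀ j ∉ T, θ j = 0) (h0 : 0 < α) (h1 : α ≤ 1 / 4)
    (hz : 1 ≤ z) (hαz : 2304 * exp (-z ^ 2 / 4) ≤ α) {i : Fin n} (hi : i ∉ T) :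
    ∏ j ∈ Finset.univ.erase i,
        ∫⁻ x, ENNReal.ofReal (exp (tilt phi g α x)) ∂gaussianReal (θ j) 1 ≤
      ENNReal.ofReal (exp (T.card / 2 - α / (1728 * z) * (n - T.card - 1))) := by
  have hsub : T ⊆ Finset.univ.erase i :=
    fun j hj => Finset.mem_erase.2 ⟨fun h => hi (h ▸ hj), Finset.mem_univ j⟩
  have hcard : (((Finset.univ.erase i) \ T).card : ℝ) = n - T.card - 1 := by
    rw [Finset.cast_card_sdiff hsub, Finset.cast_card_erase_of_mem (Finset.mem_univ i),
      Finset.card_fin]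
    ring
  have hsignal : ∀ j ∈ T, ∫⁻ x, ENNReal.ofReal (exp (tilt phi g α x)) ∂gaussianReal (θ j) 1 ≤
      ENNReal.ofReal (exp (1 / 2)) := fun j _ =>
    calc ∫⁻ x, ENNReal.ofReal (exp (tilt phi g α x)) ∂gaussianReal (θ j) 1
        ≤ ∫⁻ _, ENNReal.ofReal (exp (1 / 2)) ∂gaussianReal (θ j) 1 :=
          lintegral_mono fun x => ENNReal.ofReal_le_ofReal
            (exp_le_exp.2 (tilt_le_half phi_pos g_pos h0 (by linarith) x))
      _ = ENNReal.ofReal (exp (1 / 2)) := by rw [lintegral_const, measure_univ, mul_one]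
  have hnoise : ∀ j ∈ (Finset.univ.erase i) \ T,
      ∫⁻ x, ENNReal.ofReal (exp (tilt phi g α x)) ∂gaussianReal (θ j) 1 ≤
        ENNReal.ofReal (exp (-(α / (1728 * z)))) := by
    intro j hj
    rw [hT j (Finset.mem_sdiff.1 hj).2]
    exact lintegral_exp_tilt_le h0 h1 hz hαz
  rw [← Finset.prod_sdiff hsub]
  refine (mul_le_mul' (Finset.prod_le_pow_card _ _ _ hnoise)
    (Finset.prod_le_pow_card _ _ _ hsignal)).trans_eq ?_
  rw [← ENNReal.ofReal_pow (exp_pos _).le, ← ENNReal.ofReal_pow (exp_pos _).le, ← exp_nat_mul,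
    ← exp_nat_mul, ← ENNReal.ofReal_mul (exp_pos _).le, ← exp_add, hcard]
  ring_nf

theorem lintegral_noise_mul_prod_le (hT : ∀ j ∉ T, θ j = 0) (h0 : 0 < α) (h1 : α ≤ 1 / 4)
    (hz : 1 ≤ z) (hαz : 2304 * exp (-z ^ 2 / 4) ≤ α) {i : Fin n} (hi : i ∉ T) :
    ∫⁻ X, ENNReal.ofReal (1 + X i ^ 2) * ∏ j, ENNReal.ofReal (exp (tilt phi g α (X j)))
        ∂dataLaw θ ≤
      ENNReal.ofReal (4 * exp (T.card / 2 - α / (1728 * z) * (n - T.card - 1))) := by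
  have htilt : Measurable fun x => ENNReal.ofReal (exp (tilt phi g α x)) :=
    (measurable_tilt α).exp.ennreal_ofReal
  rw [dataLaw, lintegral_pi_mul_prod _ (u := fun x => ENNReal.ofReal (1 + x ^ 2))
    (by fun_prop) htilt, ENNReal.ofReal_mul (by norm_num)]
  refine mul_le_mul' ?_ (prod_lintegral_exp_tilt_le hT h0 h1 hz hαz hi)
  rw [hT i hi]
  simp only [← ENNReal.ofReal_mul (add_nonneg zero_le_one (sq_nonneg _))]
  exact lintegral_sq_mul_exp_tilt_le h0 (by linarith)

end NoiseUnderTilt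

section LargeSample

/-- The threshold `t_n` up to which an estimate of the weight is left unmodified. -/
noncomputable def cutoff (n : ℕ) : ℝ := √(2 * log n - 5 * log (log n))

/-- The weight `t⁻¹(√(2 (1 + A) log n))` that replaces an estimate with threshold above `t_n`. -/
noncomputable def fallbackWeight (A : ℝ) (n : ℕ) : ℝ := weightOf √(2 * (1 + A) * log n)

/-- The sample size is so large that powers of its logarithm are dominated as needed. -/
structure LargeSample (A : ℝ) (n : ℕ) : Prop where
  pos : 0 < n
  log_ge : 200000 ≤ log n
  log_log_le : 5 * log (log n) ≤ log n
  log_pow_le_exp : 864 * (3 + 2 * A) * log n ^ 4 ≤ exp (A * log n)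
  log_pow_le_sqrt : (9 + 4 * A) * log n ^ 5 ≤ √n
  log_pow_le_self : 10 ^ 10 * log n ^ 3 ≤ n

theorem eventually_mul_pow_le_exp (c : ℝ) (k : ℕ) {b : ℝ} (hb : 0 < b) :
    ∀ᶠ x : ℝ in atTop, c * x ^ k ≤ exp (b * x) := by
  have h := (isLittleO_pow_exp_pos_mul_atTop k hb).def (c := 1 / (|c| + 1)) (by positivity)
  filter_upwards [h, eventually_ge_atTop 0] with x hx h0
  rw [norm_of_nonneg (by positivity), norm_of_nonneg (exp_pos _).le,
    one_div_mul_eq_div, le_div_iff₀ (by positivity)] at hx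
  have : c * x ^ k ≤ (|c| + 1) * x ^ k := by
    gcongr
    linarith [le_abs_self c]
  linarith

theorem eventually_mul_log_le (c : ℝ) : ∀ᶠ x : ℝ in atTop, c * log x ≤ x := by
  have h := isLittleO_log_id_atTop.def (c := 1 / (|c| + 1)) (by positivity)
  filter_upwards [h, eventually_ge_atTop 1] with x hx h1
  rw [norm_of_nonneg (log_nonneg h1), id, norm_of_nonneg (by linarith),
    one_div_mul_eq_div, le_div_iff₀ (by positivity)] at hx
  nlinarith [le_abs_self c, log_nonneg h1]

theorem eventually_largeSample {A : ℝ} (hA : 0 < A) : ∀ᶠ n : ℕ in atTop, LargeSample A n := by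
  have ht : Tendsto (fun n : ℕ => log n) atTop atTop :=
    tendsto_log_atTop.comp tendsto_natCast_atTop_atTop
  filter_upwards [eventually_gt_atTop 0, ht.eventually (eventually_ge_atTop 200000),
    ht.eventually (eventually_mul_log_le 5),
    ht.eventually (eventually_mul_pow_le_exp (864 * (3 + 2 * A)) 4 hA),
    ht.eventually (eventually_mul_pow_le_exp (9 + 4 * A) 5 (b := 1 / 2) (by norm_num)),
    ht.eventually (eventually_mul_pow_le_exp (10 ^ 10) 3 one_pos)] with n h0 h1 h2 h3 h4 h5
  have hn : exp (log n) = n := exp_log (Nat.cast_pos.2 h0)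
  have hsqrt : exp (1 / 2 * log n) = √n := by
    rw [← hn, ← exp_half, log_exp, one_div_mul_eq_div]
  exact ⟨h0, h1, h2, h3, hsqrt ▸ h4, by rwa [one_mul, hn] at h5⟩

namespace LargeSample

variable {A : ℝ} {n : ℕ}

theorem cast_pos (h : LargeSample A n) : (0 : ℝ) < n := Nat.cast_pos.2 h.pos

theorem log_pos (h : LargeSample A n) : 0 < log n := by linarith [h.log_ge]

theorem one_le_sqrt_log (h : LargeSample A n) : 1 ≤ √(log n) :=
  one_le_sqrt.2 (by linarith [h.log_ge])

theorem sq_sqrt_log (h : LargeSample A n) : √(log n) ^ 2 = log n := sq_sqrt h.log_pos.le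

theorem sqrt_log_le (h : LargeSample A n) : √(log n) ≤ log n := by
  nlinarith [h.one_le_sqrt_log, h.sq_sqrt_log]

theorem sqrt_log_pow_five_le (h : LargeSample A n) : √(log n) ^ 5 ≤ log n ^ 3 := by
  rw [← h.sq_sqrt_log, ← pow_mul, h.sq_sqrt_log]
  exact pow_le_pow_right₀ h.one_le_sqrt_log (by norm_num)

theorem log_sq_le (h : LargeSample A n) : log n ^ 2 ≤ 1 / 10 ^ 10 * n := by
  have : log n ^ 2 ≤ log n ^ 3 := pow_le_pow_right₀ (by linarith [h.log_ge]) (by norm_num)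
  linarith [h.log_pow_le_self]

theorem alphaMin_le (h : LargeSample A n) : alphaMin n ≤ 54 * (1 + 2 * log n) / n := by
  have hL := h.log_ge
  have hw := weightOf_le (t := √(2 * log n)) (one_le_sqrt.2 (by linarith))
  rwa [sq_sqrt (by linarith), neg_div, mul_div_cancel_left₀ _ two_ne_zero, exp_neg,
    exp_log h.cast_pos, ← thresholdInv_eq_weightOf (sqrt_nonneg _)] at hw

theorem cutoff_sq (h : LargeSample A n) : cutoff n ^ 2 = 2 * log n - 5 * log (log n) :=
  sq_sqrt (by linarith [h.log_pos, h.log_log_le])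

theorem exp_cutoff_sq (h : LargeSample A n) : exp (cutoff n ^ 2 / 2) = n / √(log n) ^ 5 := by
  have hloglog : log (log n) = 2 * log √(log n) := by
    rw [log_sqrt h.log_pos.le]; ring
  rw [h.cutoff_sq, hloglog, show (2 * log n - 5 * (2 * log √(log n))) / 2 =
    log n - (5 : ℕ) * log √(log n) by push_cast; ring, exp_sub, exp_log h.cast_pos,
    exp_nat_mul, exp_log (by linarith [h.one_le_sqrt_log])]

theorem lt_weightOf_cutoff (h : LargeSample A n) :
    2 * 6912 * √(log n) ^ 5 / n < weightOf (cutoff n) := by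
  have hL := h.log_ge
  have hn := h.cast_pos
  have hpow := h.sqrt_log_pow_five_le
  have hlog : log n ≤ 1 + cutoff n ^ 2 := by linarith [h.cutoff_sq, h.log_log_le]
  refine lt_of_lt_of_le ?_ (le_weightOf (sqrt_nonneg _))
  rw [h.exp_cutoff_sq]
  set x := √(log n)
  have hx : 0 < x := by linarith [h.one_le_sqrt_log]
  rw [div_lt_div_iff₀ hn (by positivity), one_mul]
  have hhalf : 82944 * n / log n ≤ n / 2 := by
    rw [div_le_div_iff₀ (by linarith) two_pos]
    nlinarith
  calc 2 * 6912 * x ^ 5 * (1 + 6 * (n / x ^ 5) / (1 + cutoff n ^ 2))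
      ≤ 2 * 6912 * x ^ 5 * (1 + 6 * (n / x ^ 5) / log n) := by gcongr
    _ = 13824 * x ^ 5 + 82944 * n / log n := by field_simp; ring
    _ < n := by linarith [h.log_pow_le_self]

theorem weightOf_cutoff_le (h : LargeSample A n) :
    weightOf (cutoff n) ≤ 162 * log n ^ 4 / n := by
  have hL := h.log_ge
  have hn := h.cast_pos
  have hlog : 0 ≤ log (log n) := log_nonneg (by linarith)
  refine (weightOf_le (one_le_sqrt.2 (by linarith [h.log_log_le]))).trans ?_
  rw [← cutoff, neg_div, exp_neg, h.exp_cutoff_sq, inv_div, ← mul_div_assoc, h.cutoff_sq]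
  gcongr ?_ / _
  calc 54 * (1 + (2 * log n - 5 * log (log n))) * √(log n) ^ 5
      ≤ 54 * (3 * log n) * log n ^ 3 := by
        gcongr
        · linarith
        · exact h.sqrt_log_pow_five_le
    _ = 162 * log n ^ 4 := by ring

theorem mul_weightOf_cutoff_le (h : LargeSample A n) (hA : 0 < A) {s : ℝ} (hs : √n ≤ s) :
    (4 * (2 + A) * log n + 1) * weightOf (cutoff n) ≤ 1152 * (s / n) := by
  have hL := h.log_ge
  have hn := h.cast_pos
  have hw := h.weightOf_cutoff_le
  have hw0 := (weightOf_mem_Ioc (sqrt_nonneg (2 * log n - 5 * log (log n)))).1.le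
  have hsqrt := h.log_pow_le_sqrt
  calc (4 * (2 + A) * log n + 1) * weightOf (cutoff n)
      ≤ ((9 + 4 * A) * log n) * (162 * log n ^ 4 / n) := by
        gcongr
        nlinarith
    _ = 162 * ((9 + 4 * A) * log n ^ 5) / n := by ring
    _ ≤ 1152 * s / n := by
        gcongr ?_ / _
        nlinarith [sqrt_nonneg (n : ℝ)]
    _ = 1152 * (s / n) := by ring

theorem fallbackWeight_mul_sqrt_log_le (h : LargeSample A n) (hA : 0 < A) :
    16 * fallbackWeight A n * √(log n) ≤ 1 / n := by
  have hL := h.log_ge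
  have hn := h.cast_pos
  have hw : fallbackWeight A n ≤ 54 * (1 + 2 * (1 + A) * log n) * (n * exp (A * log n))⁻¹ := by
    have hw := weightOf_le (t := √(2 * (1 + A) * log n)) (one_le_sqrt.2 (by nlinarith))
    rwa [sq_sqrt (by nlinarith), neg_div, show 2 * (1 + A) * log n / 2 = log n + A * log n by ring,
      exp_neg, exp_add, exp_log hn] at hw
  have hexp : 864 * (1 + 2 * (1 + A) * log n) * √(log n) ≤ exp (A * log n) := by
    refine le_trans ?_ h.log_pow_le_exp
    have hpow : log n ^ 2 ≤ log n ^ 4 := pow_le_pow_right₀ (by linarith) (by norm_num)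
    calc 864 * (1 + 2 * (1 + A) * log n) * √(log n) ≤ 864 * ((3 + 2 * A) * log n) * log n := by
          gcongr
          · nlinarith
          · exact h.sqrt_log_le
      _ = 864 * (3 + 2 * A) * log n ^ 2 := by ring
      _ ≤ 864 * (3 + 2 * A) * log n ^ 4 := by gcongr
  calc 16 * fallbackWeight A n * √(log n)
      ≤ 16 * (54 * (1 + 2 * (1 + A) * log n) * (n * exp (A * log n))⁻¹) * √(log n) := by gcongr
    _ = 864 * (1 + 2 * (1 + A) * log n) * √(log n) / exp (A * log n) / n := by field_simp; ring
    _ ≤ 1 / n := by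
        gcongr
        exact (div_le_one (exp_pos _)).2 hexp

theorem exp_le_fallbackWeight (h : LargeSample A n) (hA : 0 < A) :
    1152 * exp (-(4 * (2 + A) * log n) / 4) ≤ fallbackWeight A n := by
  have hL := h.log_ge
  have hexp : exp (-(4 * (2 + A) * log n) / 4) = (n * exp ((1 + A) * log n))⁻¹ := by
    rw [← exp_log h.cast_pos, log_exp, ← exp_add, ← exp_neg]
    ring_nf
  have hn : 8064 ≤ (n : ℝ) := by
    linarith [add_one_le_exp (log n), exp_log h.cast_pos]
  refine le_trans ?_ (le_weightOf (sqrt_nonneg _))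
  rw [sq_sqrt (by nlinarith), show 2 * (1 + A) * log n / 2 = (1 + A) * log n by ring, hexp,
    le_div_iff₀ (by positivity)]
  have hE : 1 ≤ exp ((1 + A) * log n) := one_le_exp (by nlinarith)
  set E := exp ((1 + A) * log n)
  calc 1152 * (n * E)⁻¹ * (1 + 6 * E / (1 + 2 * (1 + A) * log n))
      ≤ 1152 * (n * E)⁻¹ * (7 * E) := by
        gcongr
        linarith [div_le_self (a := 6 * E) (b := 1 + 2 * (1 + A) * log n) (by positivity)
          (by nlinarith)]
    _ = 8064 / n := by field_simp; norm_num
    _ ≤ 1 := (div_le_one (by linarith)).2 hn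

end LargeSample

end LargeSample

section UpperWeight

theorem one_le_log_div {x y : ℝ} (hy : 0 < y) (hyx : y ≤ 1 / 10 ^ 10 * x) :
    1 ≤ log (x / y) := by
  have hdiv : 10 ^ 10 ≤ x / y := by rw [le_div_iff₀ hy]; linarith
  rw [le_log_iff_exp_le (by linarith)]
  linarith [exp_one_lt_d9]

theorem exp_neg_log_div {x y : ℝ} (hx : 0 < x) (hy : 0 < y) : exp (-log (x / y)) = y / x := by
  rw [exp_neg, exp_log (div_pos hx hy), inv_div]

/-- The level `z` with `exp (-z² / 4) = σ / n`, at which the noise is truncated. -/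
noncomputable def noiseLevel (n : ℕ) (σ : ℝ) : ℝ := 2 * √(log (n / σ))

/-- The weight that an estimate exceeds with small probability only, when at most `σ` coefficients
are nonzero. The constant makes the exponent of `lintegral_noise_mul_prod_le` a multiple of `-σ`
that dominates both `σ / 2` and `log n`. -/
noncomputable def upperWeight (n : ℕ) (σ : ℝ) : ℝ := 6912 * (σ / n) * noiseLevel n σ

section

variable {n : ℕ} {σ : ℝ} (hσ : 0 < σ) (hσn : σ ≤ 1 / 10 ^ 10 * n)

include hσ hσn

theorem one_le_noiseLevel : 1 ≤ noiseLevel n σ := by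
  have : 1 ≤ √(log (n / σ)) := one_le_sqrt.2 (one_le_log_div hσ hσn)
  rw [noiseLevel]
  linarith

theorem noiseLevel_sq : noiseLevel n σ ^ 2 = 4 * log (n / σ) := by
  rw [noiseLevel, mul_pow, sq_sqrt (by linarith [one_le_log_div hσ hσn])]
  norm_num

theorem exp_neg_noiseLevel_sq : exp (-noiseLevel n σ ^ 2 / 4) = σ / n := by
  rw [← exp_neg_log_div (by linarith) hσ, noiseLevel_sq hσ hσn]
  ring_nf

theorem le_upperWeight : 6912 * (σ / n) ≤ upperWeight n σ :=
  le_mul_of_one_le_right (by positivity) (one_le_noiseLevel hσ hσn)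

theorem upperWeight_pos : 0 < upperWeight n σ := by
  have hn : (0 : ℝ) < n := by linarith
  exact lt_of_lt_of_le (by positivity) (le_upperWeight hσ hσn)

theorem upperWeight_le_quarter : upperWeight n σ ≤ 1 / 4 := by
  have hy : 10 ^ 10 ≤ n / σ := by rw [le_div_iff₀ hσ]; linarith
  have hsqrt : 10 ^ 5 ≤ √(n / σ) := le_sqrt_of_sq_le (by norm_num at hy ⊢; exact hy)
  have hlog : √(log (n / σ)) ≤ √(n / σ) :=
    sqrt_le_sqrt ((log_le_sub_one_of_pos (by linarith)).trans (by linarith))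
  calc upperWeight n σ = 13824 * √(log (n / σ)) / √(n / σ) ^ 2 := by
        rw [upperWeight, noiseLevel, sq_sqrt (by linarith)]
        field_simp
        ring
    _ ≤ 13824 * √(n / σ) / √(n / σ) ^ 2 := by gcongr
    _ = 13824 / √(n / σ) := by field_simp
    _ ≤ 13824 / 10 ^ 5 := by gcongr
    _ ≤ 1 / 4 := by norm_num

theorem alphaMin_le_upperWeight {A : ℝ} (h : LargeSample A n) (hlog : log n ^ 2 ≤ σ) :
    alphaMin n ≤ upperWeight n σ := by
  have hn := h.cast_pos
  calc alphaMin n ≤ 54 * (1 + 2 * log n) / n := h.alphaMin_le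
    _ ≤ 6912 * log n ^ 2 / n := by
        gcongr ?_ / _
        nlinarith [h.log_ge]
    _ ≤ 6912 * σ / n := by gcongr
    _ = 6912 * (σ / n) := mul_div_assoc _ _ _
    _ ≤ upperWeight n σ := le_upperWeight hσ hσn

theorem fallbackWeight_le_upperWeight {A : ℝ} (h : LargeSample A n) (hA : 0 < A) (h1 : 1 ≤ σ) :
    fallbackWeight A n ≤ upperWeight n σ := by
  have hn := h.cast_pos
  have hw : 0 < fallbackWeight A n := (weightOf_mem_Ioc (sqrt_nonneg _)).1
  calc fallbackWeight A n ≤ 16 * fallbackWeight A n * √(log n) := by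
        nlinarith [h.one_le_sqrt_log]
    _ ≤ 1 / n := h.fallbackWeight_mul_sqrt_log_le hA
    _ ≤ 6912 * σ / n := by
        gcongr
        linarith
    _ = 6912 * (σ / n) := mul_div_assoc _ _ _
    _ ≤ upperWeight n σ := le_upperWeight hσ hσn

end

theorem upperWeight_log_sq_lt {A : ℝ} {n : ℕ} (h : LargeSample A n) :
    upperWeight n (log n ^ 2) < weightOf (cutoff n) := by
  have hL := h.log_ge
  have hn := h.cast_pos
  have hsqrt : √(log (n / log n ^ 2)) ≤ √(log n) :=
    sqrt_le_sqrt <| log_le_log (by positivity) <| div_le_self hn.le (one_le_pow₀ (by linarith))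
  calc upperWeight n (log n ^ 2) ≤ 6912 * (log n ^ 2 / n) * (2 * √(log n)) := by
        unfold upperWeight noiseLevel
        gcongr
    _ = 2 * 6912 * √(log n) ^ 5 / n := by
        nth_rw 1 [← h.sq_sqrt_log]
        ring
    _ < weightOf (cutoff n) := h.lt_weightOf_cutoff

end UpperWeight

section Modification

variable {A a s : ℝ} {n : ℕ} {X : Fin n → ℝ}

theorem fallbackWeight_mem_Ioc : fallbackWeight A n ∈ Ioc 0 1 := weightOf_mem_Ioc (sqrt_nonneg _)

theorem modify_of_le (h0 : 0 < a) (h1 : a ≤ 1) (h : weightOf (cutoff n) ≤ a) :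
    modify A n a = a :=
  if_pos ((threshold_le_iff h0 h1 (sqrt_nonneg _)).2 h)

theorem modify_of_lt (h0 : 0 < a) (h1 : a ≤ 1) (h : a < weightOf (cutoff n)) :
    modify A n a = fallbackWeight A n :=
  (if_neg (mt (threshold_le_iff h0 h1 (sqrt_nonneg _)).1 h.not_ge)).trans
    (thresholdInv_eq_weightOf (sqrt_nonneg _))

theorem alphaMin_pos (n : ℕ) : 0 < alphaMin n := by
  rw [alphaMin, thresholdInv_eq_weightOf (sqrt_nonneg _)]
  exact (weightOf_mem_Ioc (sqrt_nonneg _)).1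

theorem IsMMLE.pos (ha : IsMMLE X a) : 0 < a := (alphaMin_pos n).trans_le ha.1.1

theorem IsMMLE.le_one (ha : IsMMLE X a) : a ≤ 1 := ha.1.2

theorem IsMMLE.modify_mem_Ioc (ha : IsMMLE X a) : modify A n a ∈ Ioc 0 1 := by
  rcases le_or_gt (weightOf (cutoff n)) a with h | h
  · rw [modify_of_le ha.pos ha.le_one h]
    exact ⟨ha.pos, ha.le_one⟩
  · rw [modify_of_lt ha.pos ha.le_one h]
    exact fallbackWeight_mem_Ioc

end Modification

section SignalSum

variable {A a s : ℝ} {n : ℕ} {X : Fin n → ℝ} {T : Finset (Fin n)}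

theorem IsMMLE.sum_le_card_mul_add (ha : IsMMLE X a) {b d : ℝ} (hd : 0 ≤ d) {f : Fin n → ℝ}
    (hf : ∀ i ∈ T, f i ≤ b + d * (g (X i) / mixture phi g a (X i))) :
    ∑ i ∈ T, f i ≤ T.card * b + d * n := by
  have hsum : ∑ i ∈ T, g (X i) / mixture phi g a (X i) ≤ n := by
    calc ∑ i ∈ T, g (X i) / mixture phi g a (X i) ≤ ∑ i, g (X i) / mixture phi g a (X i) :=
          Finset.sum_le_univ_sum_of_nonneg
            fun i => div_mixture_nonneg phi_pos g_pos ha.pos ha.le_one (X i)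
      _ ≤ Fintype.card (Fin n) :=
          sum_div_mixture_le_card phi_pos g_pos (alphaMin_pos n) ha.1 ha.2
      _ = n := by rw [Fintype.card_fin]
  calc ∑ i ∈ T, f i ≤ ∑ i ∈ T, (b + d * (g (X i) / mixture phi g a (X i))) :=
        Finset.sum_le_sum hf
    _ = T.card * b + d * ∑ i ∈ T, g (X i) / mixture phi g a (X i) := by
        rw [Finset.sum_add_distrib, Finset.sum_const, nsmul_eq_mul, Finset.mul_sum]
    _ ≤ T.card * b + d * n := by gcongr

theorem IsMMLE.sum_one_sub_weight_mul_sq_le (ha : IsMMLE X a) (hs : 0 < s)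
    (hsn : s ≤ 1 / 10 ^ 10 * n) (hT : T.card ≤ s) :
    ∑ i ∈ T, (1 - weight a (X i)) * X i ^ 2 ≤ 4 * (s * log (n / s)) + 1152 * s := by
  have hl := one_le_log_div hs hsn
  have hn : (0 : ℝ) < n := by linarith
  calc ∑ i ∈ T, (1 - weight a (X i)) * X i ^ 2
      ≤ T.card * (4 * log (n / s)) + 1152 * (s / n) * n :=
        ha.sum_le_card_mul_add (by positivity) fun i _ => by
          rw [← exp_neg_log_div hn hs, ← mul_div_cancel_left₀ (-log (n / s)) four_ne_zero, mul_neg]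
          exact one_sub_weight_mul_sq_le_add ha.pos ha.le_one (by linarith) (X i)
    _ ≤ s * (4 * log (n / s)) + 1152 * (s / n) * n := by gcongr
    _ = 4 * (s * log (n / s)) + 1152 * s := by field_simp

theorem IsMMLE.sum_one_sub_fallbackWeight_mul_sq_le_of_sqrt_le (ha : IsMMLE X a) (hA : 0 < A)
    (h : LargeSample A n) (hlt : a < weightOf (cutoff n)) (hs : 0 < s)
    (hsn : s ≤ 1 / 10 ^ 10 * n) (hsqrt : √n ≤ s) (hT : T.card ≤ s) :
    ∑ i ∈ T, (1 - weight (fallbackWeight A n) (X i)) * X i ^ 2 ≤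
      4 * (s * log (n / s)) + 2304 * s := by
  have hl := one_le_log_div hs hsn
  have hlog := h.log_pos
  have hn := h.cast_pos
  have hmul : (4 * (2 + A) * log n + 1) * a ≤ 1152 * (s / n) := by
    refine le_trans ?_ (h.mul_weightOf_cutoff_le hA hsqrt)
    gcongr
  calc ∑ i ∈ T, (1 - weight (fallbackWeight A n) (X i)) * X i ^ 2
      ≤ T.card * (4 * log (n / s)) + 2304 * (s / n) * n :=
        ha.sum_le_card_mul_add (by positivity) fun i _ => by
          rw [← exp_neg_log_div hn hs, ← mul_div_cancel_left₀ (-log (n / s)) four_ne_zero,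
            mul_neg] at hmul ⊢
          exact one_sub_weight_mul_sq_le_add_of_mul_le fallbackWeight_mem_Ioc.1
            fallbackWeight_mem_Ioc.2 (by positivity) (h.exp_le_fallbackWeight hA) ha.pos ha.le_one
            (by linarith) hmul (X i)
    _ ≤ s * (4 * log (n / s)) + 2304 * (s / n) * n := by gcongr
    _ = 4 * (s * log (n / s)) + 2304 * s := by field_simp

theorem log_le_two_mul_log_div (hs : 0 < s) (hsqrt : s ≤ √n) : log n ≤ 2 * log (n / s) := by
  have hn : (0 : ℝ) < n := sqrt_pos.1 (hs.trans_le hsqrt)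
  have hdiv : √n ≤ n / s := by
    rw [← div_sqrt]
    gcongr
  have hlog := log_le_log (sqrt_pos.2 hn) hdiv
  rw [log_sqrt hn.le] at hlog
  linarith

theorem sum_one_sub_fallbackWeight_mul_sq_le_of_le_sqrt (hA : 0 < A) (h : LargeSample A n)
    (hs : 0 < s) (hsqrt : s ≤ √n) (hT : T.card ≤ s) (X : Fin n → ℝ) :
    ∑ i ∈ T, (1 - weight (fallbackWeight A n) (X i)) * X i ^ 2 ≤
      (16 + 8 * A) * (s * log (n / s)) + s := by
  have hlog := h.log_pos
  calc ∑ i ∈ T, (1 - weight (fallbackWeight A n) (X i)) * X i ^ 2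
      ≤ T.card • (4 * (2 + A) * log n + 1) :=
        Finset.sum_le_card_nsmul T _ _ fun i _ =>
          one_sub_weight_mul_sq_le_add_one fallbackWeight_mem_Ioc.1 fallbackWeight_mem_Ioc.2
            (by positivity) (h.exp_le_fallbackWeight hA) (X i)
    _ ≤ s * (4 * (2 + A) * (2 * log (n / s)) + 1) := by
        rw [nsmul_eq_mul]
        gcongr
        exact log_le_two_mul_log_div hs hsqrt
    _ = (16 + 8 * A) * (s * log (n / s)) + s := by ring

theorem IsMMLE.sum_one_sub_weight_modify_mul_sq_le (ha : IsMMLE X a) (hA : 0 < A)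
    (h : LargeSample A n) (hs : 0 < s) (hsn : s ≤ 1 / 10 ^ 10 * n) (hT : T.card ≤ s) :
    ∑ i ∈ T, (1 - weight (modify A n a) (X i)) * X i ^ 2 ≤
      (2400 + 8 * A) * (s * log (n / s)) := by
  have hsl : s ≤ s * log (n / s) := le_mul_of_one_le_right hs.le (one_le_log_div hs hsn)
  have hAsl : 0 ≤ A * (s * log (n / s)) := mul_nonneg hA.le (hs.le.trans hsl)
  rcases le_or_gt (weightOf (cutoff n)) a with hle | hlt
  · rw [modify_of_le ha.pos ha.le_one hle]
    linarith [ha.sum_one_sub_weight_mul_sq_le hs hsn hT]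
  · rw [modify_of_lt ha.pos ha.le_one hlt]
    rcases le_total (√n) s with hsqrt | hsqrt
    · linarith [ha.sum_one_sub_fallbackWeight_mul_sq_le_of_sqrt_le hA h hlt hs hsn hsqrt hT]
    · linarith [sum_one_sub_fallbackWeight_mul_sq_le_of_le_sqrt hA h hs hsqrt hT X]

end SignalSum

section LossDecomposition

variable {α : ℝ} {n : ℕ} {θ X : Fin n → ℝ} {T : Finset (Fin n)}

theorem one_sub_mul_sq_add_mul_le {w c : ℝ} (hw1 : w ≤ 1) (hc : 0 ≤ c) (t x : ℝ) :
    (1 - w) * t ^ 2 + w * (2 * (x - t) ^ 2 + c) ≤ 2 * ((1 - w) * x ^ 2) + 4 * (x - t) ^ 2 + c := by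
  have hv : 0 ≤ 1 - w := by linarith
  have ht : t ^ 2 ≤ 2 * x ^ 2 + 2 * (x - t) ^ 2 := by nlinarith [sq_nonneg (2 * x - t)]
  nlinarith [mul_le_mul_of_nonneg_left ht hv, mul_nonneg hv hc,
    mul_nonneg hv (sq_nonneg (x - t))]

theorem sum_signal_loss_le (h0 : 0 < α) (h1 : α ≤ 1) :
    ∑ i ∈ T, ((1 - weight α (X i)) * θ i ^ 2 +
        weight α (X i) * (2 * (X i - θ i) ^ 2 + 192)) ≤
      2 * ∑ i ∈ T, (1 - weight α (X i)) * X i ^ 2 + 192 * T.card +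
        4 * ∑ i ∈ T, (X i - θ i) ^ 2 := by
  refine (Finset.sum_le_sum fun i _ => one_sub_mul_sq_add_mul_le (weight_le_one h0 h1 (X i))
    (by norm_num : (0 : ℝ) ≤ 192) (θ i) (X i)).trans_eq ?_
  rw [Finset.sum_add_distrib, Finset.sum_add_distrib, Finset.sum_const, nsmul_eq_mul,
    ← Finset.mul_sum, ← Finset.mul_sum]
  ring

theorem sum_noise_loss_le (h0 : 0 < α) (h1 : α ≤ 1) (hθ : ∀ i ∉ T, θ i = 0) :
    ∑ i ∈ Tᶜ, ((1 - weight α (X i)) * θ i ^ 2 +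
        weight α (X i) * (2 * (X i - θ i) ^ 2 + 192)) ≤
      192 * ∑ i ∈ Tᶜ, (1 + X i ^ 2) * weight α (X i) := by
  rw [Finset.mul_sum]
  refine Finset.sum_le_sum fun i hi => ?_
  rw [hθ i (Finset.mem_compl.1 hi)]
  nlinarith [mul_nonneg (weight_nonneg h0 h1 (X i)) (sq_nonneg (X i))]

theorem posteriorLoss_le_add (h0 : 0 < α) (h1 : α ≤ 1) (hθ : ∀ i ∉ T, θ i = 0) :
    posteriorLoss α θ X ≤
      ENNReal.ofReal (2 * ∑ i ∈ T, (1 - weight α (X i)) * X i ^ 2 + 192 * T.card) +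
      4 * ∑ i ∈ T, ENNReal.ofReal ((X i - θ i) ^ 2) +
      192 * ∑ i ∈ Tᶜ, ENNReal.ofReal ((1 + X i ^ 2) * weight α (X i)) := by
  have hshrunk : 0 ≤ ∑ i ∈ T, (1 - weight α (X i)) * X i ^ 2 :=
    Finset.sum_nonneg fun i _ =>
      mul_nonneg (by linarith [weight_le_one h0 h1 (X i)]) (sq_nonneg _)
  have hsq : ∀ i, 0 ≤ (X i - θ i) ^ 2 := fun i => sq_nonneg _
  have hweight : ∀ i, 0 ≤ (1 + X i ^ 2) * weight α (X i) :=
    fun i => mul_nonneg (by positivity) (weight_nonneg h0 h1 (X i))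
  calc posteriorLoss α θ X ≤ ENNReal.ofReal (∑ i, ((1 - weight α (X i)) * θ i ^ 2 +
        weight α (X i) * (2 * (X i - θ i) ^ 2 + 192))) := posteriorLoss_le h0 h1 θ X
    _ ≤ ENNReal.ofReal (2 * ∑ i ∈ T, (1 - weight α (X i)) * X i ^ 2 + 192 * T.card +
        4 * ∑ i ∈ T, (X i - θ i) ^ 2 + 192 * ∑ i ∈ Tᶜ, (1 + X i ^ 2) * weight α (X i)) := by
      rw [← Finset.sum_add_sum_compl T]
      exact ENNReal.ofReal_le_ofReal
        (add_le_add (sum_signal_loss_le h0 h1) (sum_noise_loss_le h0 h1 hθ))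
    _ = _ := by
      have := Finset.sum_nonneg fun i (_ : i ∈ Tᶜ) => hweight i
      rw [ENNReal.ofReal_add (by positivity) (by positivity),
        ENNReal.ofReal_add (by positivity) (by positivity),
        ENNReal.ofReal_mul (p := 4) (by norm_num), ENNReal.ofReal_mul (p := 192) (by norm_num),
        ENNReal.ofReal_sum_of_nonneg fun i _ => hsq i,
        ENNReal.ofReal_sum_of_nonneg fun i _ => hweight i, ENNReal.ofReal_ofNat,
        ENNReal.ofReal_ofNat]

end LossDecomposition

section NoiseSum

variable {A a s σ : ℝ} {n : ℕ} {X θ : Fin n → ℝ} {T : Finset (Fin n)}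

theorem lintegral_dataLaw_eval (θ : Fin n → ℝ) (i : Fin n) {f : ℝ → ℝ≥0∞} (hf : Measurable f) :
    ∫⁻ X, f (X i) ∂dataLaw θ = ∫⁻ x, f x ∂gaussianReal (θ i) 1 :=
  lintegral_pi_eval (fun i => gaussianReal (θ i) 1) i hf

/-- The deterministic weight that dominates the modified estimate unless the estimate exceeds its
`upperWeight`. For `s < (log n)²` that upper weight is below the cutoff, so that only the fallback
weight can occur. -/
noncomputable def noiseWeight (A : ℝ) (n : ℕ) (s : ℝ) : ℝ :=
  if log n ^ 2 ≤ s then upperWeight n s else fallbackWeight A n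

/-- The exponential of a multiple of the score at `upperWeight n σ`, which dominates the indicator
of the event that an estimate exceeds that weight. -/
noncomputable def exceedance (σ : ℝ) (X : Fin n → ℝ) : ℝ≥0∞ :=
  ∏ j, ENNReal.ofReal (exp (tilt phi g (upperWeight n σ) (X j)))

theorem measurable_exceedance (σ : ℝ) : Measurable (exceedance σ : (Fin n → ℝ) → ℝ≥0∞) := by
  have := measurable_tilt (upperWeight n σ)
  unfold exceedance
  fun_prop

theorem measurable_weight (α : ℝ) : Measurable (weight α) := by
  have := continuous_phi.measurable
  have := continuous_g.measurable
  unfold weight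
  fun_prop

theorem IsMMLE.one_le_exceedance (ha : IsMMLE X a) (h : LargeSample A n)
    (hσ : log n ^ 2 ≤ σ) (hσn : σ ≤ 1 / 10 ^ 10 * n) (hlt : upperWeight n σ < a) :
    1 ≤ exceedance σ X := by
  have hσ0 : 0 < σ := (pow_pos h.log_pos 2).trans_le hσ
  exact one_le_prod_exp_tilt (upperWeight_pos hσ0 hσn).le <|
    score_nonneg_of_lt_of_isMaxOn phi_pos g_pos (alphaMin_pos n) ha.le_one ha.2
      (alphaMin_le_upperWeight hσ0 hσn h hσ) hlt

theorem noiseWeight_le_one (h : LargeSample A n) (hsn : s ≤ 1 / 10 ^ 10 * n) :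
    noiseWeight A n s ≤ 1 := by
  rw [noiseWeight]
  split_ifs with hs
  · linarith [upperWeight_le_quarter ((pow_pos h.log_pos 2).trans_le hs) hsn]
  · exact fallbackWeight_mem_Ioc.2

theorem IsMMLE.modify_le_noiseWeight (ha : IsMMLE X a) (hA : 0 < A) (h : LargeSample A n)
    (hs : 1 ≤ s) (hsn : s ≤ 1 / 10 ^ 10 * n) (hle : a ≤ upperWeight n (max s (log n ^ 2))) :
    modify A n a ≤ noiseWeight A n s := by
  rw [noiseWeight]
  split_ifs with hlog
  · rw [max_eq_left hlog] at hle
    rcases le_or_gt (weightOf (cutoff n)) a with hcut | hcut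
    · rwa [modify_of_le ha.pos ha.le_one hcut]
    · rw [modify_of_lt ha.pos ha.le_one hcut]
      exact fallbackWeight_le_upperWeight (by linarith) hsn h hA hs
  · rw [max_eq_right (not_le.1 hlog).le] at hle
    exact (modify_of_lt ha.pos ha.le_one (hle.trans_lt (upperWeight_log_sq_lt h))).le

theorem IsMMLE.weight_modify_le (ha : IsMMLE X a) (hA : 0 < A) (h : LargeSample A n)
    (hs : 1 ≤ s) (hsn : s ≤ 1 / 10 ^ 10 * n) (x : ℝ) :
    ENNReal.ofReal ((1 + x ^ 2) * weight (modify A n a) x) ≤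
      ENNReal.ofReal ((1 + x ^ 2) * weight (noiseWeight A n s) x) +
      ENNReal.ofReal (1 + x ^ 2) * exceedance (max s (log n ^ 2)) X := by
  obtain ⟨hm0, hm1⟩ := ha.modify_mem_Ioc (A := A)
  rcases le_or_gt a (upperWeight n (max s (log n ^ 2))) with hle | hlt
  · refine le_add_right (ENNReal.ofReal_le_ofReal ?_)
    gcongr
    exact weight_mono hm0 (ha.modify_le_noiseWeight hA h hs hsn hle) (noiseWeight_le_one h hsn) x
  · refine le_add_left ?_
    calc ENNReal.ofReal ((1 + x ^ 2) * weight (modify A n a) x)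
        ≤ ENNReal.ofReal (1 + x ^ 2) := ENNReal.ofReal_le_ofReal <|
          mul_le_of_le_one_right (by positivity) (weight_le_one hm0 hm1 x)
      _ ≤ ENNReal.ofReal (1 + x ^ 2) * exceedance (max s (log n ^ 2)) X :=
          le_mul_of_one_le_right' <| ha.one_le_exceedance h (le_max_right _ _)
            (max_le hsn h.log_sq_le) hlt

theorem lintegral_fallbackWeight_noise_le (hA : 0 < A) (h : LargeSample A n) :
    ∫⁻ x, ENNReal.ofReal ((1 + x ^ 2) * weight (fallbackWeight A n) x) ∂gaussianReal 0 1 ≤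
      ENNReal.ofReal (25 / n) := by
  have hw := fallbackWeight_mem_Ioc (A := A) (n := n)
  have hmul := h.fallbackWeight_mul_sqrt_log_le hA
  have hn : 1 / (n : ℝ) ≤ 1 := by
    rw [div_le_one h.cast_pos]
    exact_mod_cast h.pos
  have hexp : exp (-(2 * √(log n)) ^ 2 / 4) = 1 / n := by
    rw [mul_pow, h.sq_sqrt_log, show -(2 ^ 2 * log n) / 4 = -log n by ring, exp_neg,
      exp_log h.cast_pos, one_div]
  refine (lintegral_noise_le (z := 2 * √(log n)) hw.1 ?_ (by positivity)).trans
    (ENNReal.ofReal_le_ofReal ?_)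
  · nlinarith [hw.1, h.one_le_sqrt_log]
  · rw [hexp]
    linarith [show 25 / (n : ℝ) = 25 * (1 / n) by ring]

theorem lintegral_upperWeight_noise_le (hs : 0 < s) (hsn : s ≤ 1 / 10 ^ 10 * n) :
    ∫⁻ x, ENNReal.ofReal ((1 + x ^ 2) * weight (upperWeight n s) x) ∂gaussianReal 0 1 ≤
      ENNReal.ofReal (300000 * (s * log (n / s)) / n) := by
  have hn : (0 : ℝ) < n := by linarith
  have hsl : s ≤ s * log (n / s) := le_mul_of_one_le_right hs.le (one_le_log_div hs hsn)
  refine (lintegral_noise_le (upperWeight_pos hs hsn) (by linarith [upperWeight_le_quarter hs hsn])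
    (zero_le_one.trans (one_le_noiseLevel hs hsn))).trans (ENNReal.ofReal_le_ofReal ?_)
  calc 8 * upperWeight n s * noiseLevel n s + 24 * exp (-noiseLevel n s ^ 2 / 4)
      = 55296 * (s / n) * noiseLevel n s ^ 2 + 24 * (s / n) := by
        rw [exp_neg_noiseLevel_sq hs hsn, upperWeight]
        ring
    _ = (221184 * (s * log (n / s)) + 24 * s) / n := by
        rw [noiseLevel_sq hs hsn]
        ring
    _ ≤ 300000 * (s * log (n / s)) / n := by
        gcongr
        linarith

theorem lintegral_noiseWeight_noise_le (hA : 0 < A) (h : LargeSample A n) (hs : 1 ≤ s)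
    (hsn : s ≤ 1 / 10 ^ 10 * n) :
    ∫⁻ x, ENNReal.ofReal ((1 + x ^ 2) * weight (noiseWeight A n s) x) ∂gaussianReal 0 1 ≤
      ENNReal.ofReal (300000 * (s * log (n / s)) / n) := by
  rw [noiseWeight]
  split_ifs
  · exact lintegral_upperWeight_noise_le (by linarith) hsn
  · refine (lintegral_fallbackWeight_noise_le hA h).trans (ENNReal.ofReal_le_ofReal ?_)
    gcongr
    nlinarith [one_le_log_div (by linarith) hsn]

theorem lintegral_noise_mul_exceedance_le (h : LargeSample A n) (hσ : log n ^ 2 ≤ σ)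
    (hσn : σ ≤ 1 / 10 ^ 10 * n) (hT : T.card ≤ σ) (hθ : ∀ i ∉ T, θ i = 0) {i : Fin n}
    (hi : i ∉ T) :
    ∫⁻ X, ENNReal.ofReal (1 + X i ^ 2) * exceedance σ X ∂dataLaw θ ≤ ENNReal.ofReal (4 / n) := by
  have hn := h.cast_pos
  have hL := h.log_ge
  have hσ0 : 0 < σ := (pow_pos h.log_pos 2).trans_le hσ
  have hz := one_le_noiseLevel hσ0 hσn
  refine (lintegral_noise_mul_prod_le hθ (upperWeight_pos hσ0 hσn)
    (upperWeight_le_quarter hσ0 hσn) hz ?_ hi).trans (ENNReal.ofReal_le_ofReal ?_)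
  · rw [exp_neg_noiseLevel_sq hσ0 hσn]
    exact le_trans (by gcongr; norm_num) (le_upperWeight hσ0 hσn)
  have hratio : upperWeight n σ / (1728 * noiseLevel n σ) = 4 * (σ / n) := by
    rw [upperWeight, mul_div_mul_right _ _ (by linarith)]
    ring
  have hcard : (n : ℝ) / 2 ≤ n - T.card - 1 := by
    linarith [add_one_le_exp (log n), exp_log hn]
  have hexponent : T.card / 2 - 4 * (σ / n) * (n - T.card - 1) ≤ -log n :=
    calc T.card / 2 - 4 * (σ / n) * (n - T.card - 1) ≤ σ / 2 - 4 * (σ / n) * (n / 2) := by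
          gcongr
      _ = -(3 / 2 * σ) := by field_simp; ring
      _ ≤ -log n := by nlinarith
  calc 4 * exp (T.card / 2 - upperWeight n σ / (1728 * noiseLevel n σ) * (n - T.card - 1))
      ≤ 4 * exp (-log n) := by
        rw [hratio]
        gcongr
    _ = 4 / n := by rw [exp_neg, exp_log hn, div_eq_mul_inv]

theorem lintegral_noise_add_exceedance_le (hA : 0 < A) (h : LargeSample A n) (hs : 1 ≤ s)
    (hsn : s ≤ 1 / 10 ^ 10 * n) (hT : T.card ≤ s) (hθ : ∀ i ∉ T, θ i = 0) {i : Fin n}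
    (hi : i ∉ T) :
    ∫⁻ X : Fin n → ℝ, (ENNReal.ofReal ((1 + X i ^ 2) * weight (noiseWeight A n s) (X i)) +
        ENNReal.ofReal (1 + X i ^ 2) * exceedance (max s (log n ^ 2)) X) ∂dataLaw θ ≤
      ENNReal.ofReal (300004 * (s * log (n / s)) / n) := by
  have hmeas := measurable_weight (noiseWeight A n s)
  have hl := one_le_log_div (by linarith) hsn
  rw [lintegral_add_left (by fun_prop), lintegral_dataLaw_eval θ i (f := fun x =>
    ENNReal.ofReal ((1 + x ^ 2) * weight (noiseWeight A n s) x)) (by fun_prop), hθ i hi]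
  refine (add_le_add (lintegral_noiseWeight_noise_le hA h hs hsn)
    (lintegral_noise_mul_exceedance_le h (le_max_right _ _) (max_le hsn h.log_sq_le)
      (hT.trans (le_max_left _ _)) hθ hi)).trans ?_
  rw [← ENNReal.ofReal_add (by positivity) (by positivity), ← add_div]
  gcongr
  nlinarith

end NoiseSum

section Risk

variable {A s : ℝ} {n : ℕ} {θ : Fin n → ℝ} {T : Finset (Fin n)}

theorem lintegral_sq_sub_gaussianReal (m : ℝ) :
    ∫⁻ x, ENNReal.ofReal ((x - m) ^ 2) ∂gaussianReal m 1 = 1 := by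
  have hvar := ofReal_variance (memLp_id_gaussianReal (μ := m) (v := 1) 2)
  rw [variance_id_gaussianReal, evariance_eq_lintegral_ofReal] at hvar
  simpa using hvar.symm

theorem exists_finset_card_le_of_mem_sparse (hθ : θ ∈ sparse n s) :
    ∃ T : Finset (Fin n), T.card ≤ s ∧ ∀ i ∉ T, θ i = 0 := by
  refine ⟨(toFinite {i | θ i ≠ 0}).toFinset, ?_, fun i hi => by simpa using hi⟩
  rwa [← ncard_eq_toFinset_card]

theorem lintegral_dataLaw_sq_sub (θ : Fin n → ℝ) (i : Fin n) :
    ∫⁻ X, ENNReal.ofReal ((X i - θ i) ^ 2) ∂dataLaw θ = 1 :=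
  (lintegral_dataLaw_eval θ i (f := fun x => ENNReal.ofReal ((x - θ i) ^ 2)) (by fun_prop)).trans
    (lintegral_sq_sub_gaussianReal _)

theorem card_mul_div_le {x : ℝ} (hx : 0 ≤ x) : T.card * (x / n) ≤ x := by
  have hT : (T.card : ℝ) ≤ n := by
    exact_mod_cast (Finset.card_le_univ T).trans_eq (Fintype.card_fin n)
  rw [mul_div_left_comm]
  exact mul_le_of_le_one_right hx (div_le_one_of_le₀ hT n.cast_nonneg)

theorem IsMMLE.posteriorLoss_modify_le {a : ℝ} {X : Fin n → ℝ} (ha : IsMMLE X a) (hA : 0 < A)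
    (h : LargeSample A n) (hs : 1 ≤ s) (hsn : s ≤ 1 / 10 ^ 10 * n) (hT : T.card ≤ s)
    (hθ : ∀ i ∉ T, θ i = 0) :
    posteriorLoss (modify A n a) θ X ≤
      ENNReal.ofReal ((4992 + 16 * A) * (s * log (n / s))) +
      4 * ∑ i ∈ T, ENNReal.ofReal ((X i - θ i) ^ 2) +
      192 * ∑ i ∈ Tᶜ, (ENNReal.ofReal ((1 + X i ^ 2) * weight (noiseWeight A n s) (X i)) +
        ENNReal.ofReal (1 + X i ^ 2) * exceedance (max s (log n ^ 2)) X) := by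
  have hs0 : 0 < s := by linarith
  obtain ⟨hm0, hm1⟩ := ha.modify_mem_Ioc (A := A)
  refine (posteriorLoss_le_add hm0 hm1 hθ).trans ?_
  gcongr with i
  · have hcard := hT.trans (le_mul_of_one_le_right hs0.le (one_le_log_div hs0 hsn))
    linarith [ha.sum_one_sub_weight_modify_mul_sq_le hA h hs0 hsn hT]
  · exact ha.weight_modify_le hA h hs hsn (X i)

theorem lintegral_posteriorLoss_modify_le (hA : 0 < A) (h : LargeSample A n) (hs : 1 ≤ s)
    (hsn : s ≤ 1 / 10 ^ 10 * n) (hθ : θ ∈ sparse n s) {αhat : (Fin n → ℝ) → ℝ}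
    (hα : ∀ X, IsMMLE X (αhat X)) :
    ∫⁻ X, posteriorLoss (modify A n (αhat X)) θ X ∂dataLaw θ ≤
      ENNReal.ofReal ((3 * 10 ^ 7 + 8 * A) * rate n s) := by
  obtain ⟨T, hT, hT0⟩ := exists_finset_card_le_of_mem_sparse hθ
  have hl := one_le_log_div (by linarith) hsn
  have hsl : s ≤ s * log (n / s) := le_mul_of_one_le_right (by linarith) hl
  have hmeas := measurable_weight (noiseWeight A n s)
  have hmeas' := measurable_exceedance (n := n) (max s (log n ^ 2))
  refine (lintegral_mono fun X => (hα X).posteriorLoss_modify_le hA h hs hsn hT hT0).trans ?_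
  rw [lintegral_add_left (by fun_prop), lintegral_add_left (by fun_prop), lintegral_const,
    measure_univ, mul_one, lintegral_const_mul _ (by fun_prop), lintegral_const_mul _ (by fun_prop),
    lintegral_finsetSum _ fun i _ => by fun_prop, lintegral_finsetSum _ fun i _ => by fun_prop]
  calc _ ≤ ENNReal.ofReal ((4992 + 16 * A) * (s * log (n / s))) + 4 * ∑ _i ∈ T, 1 +
        192 * ∑ _i ∈ Tᶜ, ENNReal.ofReal (300004 * (s * log (n / s)) / n) := by
        gcongr with i _ i hi
        · exact (lintegral_dataLaw_sq_sub θ i).le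
        · exact lintegral_noise_add_exceedance_le hA h hs hsn hT hT0 (Finset.mem_compl.1 hi)
    _ = ENNReal.ofReal ((4992 + 16 * A) * (s * log (n / s)) + 4 * T.card +
          192 * (Tᶜ.card * (300004 * (s * log (n / s)) / n))) := by
        rw [ENNReal.ofReal_add (by positivity) (by positivity),
          ENNReal.ofReal_add (by positivity) (by positivity),
          ENNReal.ofReal_mul (p := 4) (by norm_num), ENNReal.ofReal_mul (p := 192) (by norm_num),
          ENNReal.ofReal_mul (p := (Tᶜ.card : ℝ)) (by positivity)]
        simp only [Finset.sum_const, nsmul_eq_mul, mul_one, ENNReal.ofReal_natCast,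
          ENNReal.ofReal_ofNat]
    _ ≤ ENNReal.ofReal ((3 * 10 ^ 7 + 8 * A) * rate n s) := by
        apply ENNReal.ofReal_le_ofReal
        have hnoise : Tᶜ.card * (300004 * (s * log (n / s)) / n) ≤ 300004 * (s * log (n / s)) :=
          card_mul_div_le (by positivity)
        rw [rate, mul_assoc 2 s]
        nlinarith

end Risk

end SpikeSlab

theorem theorem5 (A : ℝ) (hA : 0 < A) :
    ∃ C : ℝ, 0 < C ∧ ∃ c₀ : ℝ, 0 < c₀ ∧ ∃ N₀ : ℕ, 0 < N₀ ∧
      ∀ n : ℕ, N₀ ≤ n → ∀ s : ℝ, 1 ≤ s → s ≤ c₀ * n →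
      ∀ αhat : (Fin n → ℝ) → ℝ, (∀ X, SpikeSlab.IsMMLE X (αhat X)) →
        (⨆ θ₀ ∈ SpikeSlab.sparse n s,
            ∫⁻ X, SpikeSlab.posteriorLoss (SpikeSlab.modify A n (αhat X)) θ₀ X
              ∂(SpikeSlab.dataLaw θ₀))
          ≤ ENNReal.ofReal (C * SpikeSlab.rate n s) := by
  obtain ⟨N, hN⟩ := Filter.eventually_atTop.1 (SpikeSlab.eventually_largeSample hA)
  refine ⟨3 * 10 ^ 7 + 8 * A, by positivity, 1 / 10 ^ 10, by norm_num, N + 1, N.succ_pos,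
    fun n hn s hs hsn αhat hα => iSup₂_le fun θ₀ hθ₀ => ?_⟩
  exact SpikeSlab.lintegral_posteriorLoss_modify_le hA (hN n (by lia)) hs hsn hθ₀ hα
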